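/- **Theorem 3.5.** Let $0<q<1$. *Functions.* Let $\mathrm{Pol}(\mathbb C)_q$ be the complex unital $*$-algebra with generator $z$ and relation $z^*z=q^2zz^*+1-q^2$. It acts by a representation $T$ on the space $H$ with basis $v_n$ $(n\ge 0)$ by $zv_n=v_{n+1}$, $z^*v_n=(1-q^{2n})v_{n-1}$ ($z^*v_0=0$), and $H$ carries the scalar product for which the $v_n$ are orthogonal with $(v_n,v_n)=\prod_{j=1}^n(1-q^{2j})$, so that $T(f^*)=T(f)^*$; note that $(1-zz^*)v_n=q^{2n}v_n$. Let $D(U)_q'$ (distributions) be the completion of $\mathrm{Pol}(\mathbb C)_q$ in the topology of convergence of each matrix element of $T(f)$; it is identified with the space of all infinite matrices $(f_{mn})_{m,n\ge0}$. Let $D(U)_q\subset D(U)_q'$ (finite functions) be the subspace of matrices with finitely many non-zero entries. Product and involution extend by continuity. Put $$\int_{U_q} f\,d\mu=(1-q^2)\sum_{m\ge0}f_{mm}q^{2m},\qquad \int_{U_q} f\,d\nu=\int_{U_q} f\,(1-zz^*)^{-2}\,d\mu .$$ *The operator $\Box$.* The bimodule of $(0,1)$-forms consists of the $f\,dz^*$,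 with $dz^*z=q^2z\,dz^*$, $dz^*z^*=q^{-2}z^*dz^*$; $\bar\partial$ is the map from functions to $(0,1)$-forms with $\bar\partial z=0$, $\bar\partial z^*=dz^*$, $\bar\partial(fg)=(\bar\partial f)g+f\bar\partial g$, extended by continuity to $D(U)_q$. Let $L^2(d\nu)_q$ and $L^2(d\mu)_q$ be the completions of $D(U)_q$ and of $\{f\,dz^*: f\in D(U)_q\}$ for the norms $\|f\|^2=\int f^*f\,d\nu$ and $\|f\,dz^*\|^2=\int f^*f\,d\mu$; the inclusion $D(U)_q\subset D(U)_q'$ extends by continuity to an inclusion of $L^2(d\nu)_q$ in $D(U)_q'$. *Kernels.* In $\mathrm{Pol}(\mathbb C)_q^{op}\otimes\mathrm{Pol}(\mathbb C)_q$ denote $z\otimes1$, $z^*\otimes1$, $1\otimes z$, $1\otimes z^*$ by $z,z^*,\zeta,\zeta^*$, and let $D(U\times U)_q'$ be the completion of this space in the topology of convergence of matrix elements in both factors. A kernel $K\in D(U\times U)_q'$ defines the integral operator $f\mapsto\int_{U_q}K(z,\zeta)f(\zeta)\,d\nu=(\mathrm{id}\otimes\nu)(K(1\otimes f))$ from $D(U)_q$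 to $D(U)_q'$. For $m\ge0$ let $$G_m=\Big((1-\zeta\zeta^*)(1-z^*\zeta)^{-1}\Big)^m\Big((1-z^*z)(1-z\zeta^*)^{-1}\Big)^m ,$$ with the products of $\mathrm{Pol}(\mathbb C)_q^{op}\otimes\mathrm{Pol}(\mathbb C)_q$ and the inverses expanded in geometric series; that is, $G_m$ is the limit in $D(U\times U)_q'$, as $N\to\infty$, of the elements obtained by replacing $(1-x)^{-1}$ with $\sum_{i<N}x^i$ for $x=z^*\zeta$ and $x=z\zeta^*$. *Claim.* The limits $G_m$ exist, and the series $$G=-\sum_{m=1}^\infty\frac{q^{-2}-1}{q^{-2m}-1}\,G_m$$ converges in $D(U\times U)_q'$. The operator $\bar\partial$ extends to a bounded operator $L^2(d\nu)_q\to L^2(d\mu)_q$, and $\Box=-\bar\partial^*\bar\partial$ has a bounded inverse in $L^2(d\nu)_q$. On the dense subspace $D(U)_q$ this inverse coincides with the integral operator with kernel $G$: for every $f\in D(U)_q$, as elements of $D(U)_q'$, $$\Box^{-1}f=\int_{U_q}G(z,\zeta)f(\zeta)\,d\nu .$$ -/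

import Mathlib

open scoped TensorProduct
open Filter Topology

namespace QDisc

/-! ### The algebra of polynomials on the quantum plane and its Fock representation -/

/-- The two generators `z` and `z*`. -/
inductive Gen where
  | z : Gen
  | zs : Gen

/-- The defining relation `z* z = q² z z* + 1 - q²`. -/
inductive PolRel (q : ℝ) : FreeAlgebra ℂ Gen → FreeAlgebra ℂ Gen → Prop
  | comm : PolRel q (FreeAlgebra.ι ℂ Gen.zs * FreeAlgebra.ι ℂ Gen.z)
      ((q : ℂ) ^ 2 • (FreeAlgebra.ι ℂ Gen.z * FreeAlgebra.ι ℂ Gen.zs)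
        + (1 - (q : ℂ) ^ 2) • (1 : FreeAlgebra ℂ Gen))

/-- The complex unital algebra `Pol(ℂ)_q` with generators `z, z*` and the above relation. -/
abbrev Pol (q : ℝ) : Type := RingQuot (PolRel q)

/-- The generator `z`. -/
noncomputable def z (q : ℝ) : Pol q := RingQuot.mkAlgHom ℂ (PolRel q) (FreeAlgebra.ι ℂ Gen.z)

/-- The generator `z*`. -/
noncomputable def zs (q : ℝ) : Pol q := RingQuot.mkAlgHom ℂ (PolRel q) (FreeAlgebra.ι ℂ Gen.zs)

/-- The element `y = 1 - z z*`. -/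
noncomputable def y (q : ℝ) : Pol q := 1 - z q * zs q

theorem zs_mul_z (q : ℝ) :
    zs q * z q = (q : ℂ) ^ 2 • (z q * zs q) + (1 - (q : ℂ) ^ 2) • (1 : Pol q) := by
  have h := RingQuot.mkAlgHom_rel ℂ (PolRel.comm (q := q))
  simpa [z, zs] using h

/-- The universal property of `Pol(ℂ)_q`. -/
noncomputable def Pol.lift (q : ℝ) {A : Type*} [Ring A] [Algebra ℂ A] (a b : A)
    (h : b * a = (q : ℂ) ^ 2 • (a * b) + (1 - (q : ℂ) ^ 2) • (1 : A)) : Pol q →ₐ[ℂ] A :=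
  RingQuot.liftAlgHom ℂ
    ⟨FreeAlgebra.lift ℂ (fun g => Gen.casesOn g a b), by
      intro x x' hx
      cases hx
      simpa using h⟩

theorem Pol.lift_z (q : ℝ) {A : Type*} [Ring A] [Algebra ℂ A] (a b : A)
    (h : b * a = (q : ℂ) ^ 2 • (a * b) + (1 - (q : ℂ) ^ 2) • (1 : A)) :
    Pol.lift q a b h (z q) = a := by
  simp [Pol.lift, z]

theorem Pol.lift_zs (q : ℝ) {A : Type*} [Ring A] [Algebra ℂ A] (a b : A)
    (h : b * a = (q : ℂ) ^ 2 • (a * b) + (1 - (q : ℂ) ^ 2) • (1 : A)) :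
    Pol.lift q a b h (zs q) = b := by
  simp [Pol.lift, zs]

theorem Pol.induction (q : ℝ) {P : Pol q → Prop} (hs : ∀ c : ℂ, P (algebraMap ℂ (Pol q) c))
    (hz : P (z q)) (hzs : P (zs q)) (hadd : ∀ f g, P f → P g → P (f + g))
    (hmul : ∀ f g, P f → P g → P (f * g)) (f : Pol q) : P f := by
  obtain ⟨x, rfl⟩ := RingQuot.mkAlgHom_surjective ℂ (PolRel q) f
  induction x using FreeAlgebra.induction with
  | grade0 c => rw [AlgHom.commutes]; exact hs c
  | grade1 g =>
    cases g
    · exact hz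
    · exact hzs
  | mul a b ha hb => rw [map_mul]; exact hmul _ _ ha hb
  | add a b ha hb => rw [map_add]; exact hadd _ _ ha hb

/-- The underlying space of the module `H`, with `Finsupp.single n 1` in the role of the basis
vector `v_n = z^n v_0`. -/
abbrev Fock : Type := ℕ →₀ ℂ

/-- The action of `z` on `H`: `v_n ↦ v_{n+1}`. -/
noncomputable def raise : Module.End ℂ Fock :=
  Finsupp.linearCombination ℂ (fun n : ℕ => (Finsupp.single (n + 1) 1 : Fock))

/-- The action of `z*` on `H`: `v_n ↦ (1 - q^{2n}) v_{n-1}` for `n ≥ 1`, and `v_0 ↦ 0`. -/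
noncomputable def lower (q : ℝ) : Module.End ℂ Fock :=
  Finsupp.linearCombination ℂ
    (fun n : ℕ => ((1 - (q : ℂ) ^ (2 * n)) • Finsupp.single (n - 1) 1 : Fock))

theorem raise_single (n : ℕ) : raise (Finsupp.single n 1) = Finsupp.single (n + 1) 1 := by
  simp [raise]

theorem lower_single (q : ℝ) (n : ℕ) :
    lower q (Finsupp.single n 1) = (1 - (q : ℂ) ^ (2 * n)) • Finsupp.single (n - 1) 1 := by
  simp [lower]

theorem lower_raise (q : ℝ) :
    lower q * raise = (q : ℂ) ^ 2 • (raise * lower q) + (1 - (q : ℂ) ^ 2) • 1 := by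
  refine Finsupp.lhom_ext' fun n => LinearMap.ext_ring ?_
  simp only [LinearMap.comp_apply, Finsupp.lsingle_apply, Module.End.mul_apply,
    LinearMap.add_apply, LinearMap.smul_apply, Module.End.one_apply, raise_single, lower_single,
    map_smul, Nat.add_sub_cancel]
  rcases n with _ | n
  · simp
  · simp only [Nat.add_sub_cancel]
    rw [smul_smul, ← add_smul]
    congr 1
    ring

/-- The representation `T` of `Pol(ℂ)_q` in `H`. -/
noncomputable def T (q : ℝ) : Pol q →ₐ[ℂ] Module.End ℂ Fock :=
  Pol.lift q raise (lower q) (lower_raise q)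

theorem T_z (q : ℝ) : T q (z q) = raise := Pol.lift_z ..

theorem T_zs (q : ℝ) : T q (zs q) = lower q := Pol.lift_zs ..

theorem T_y_single (q : ℝ) (n : ℕ) :
    T q (y q) (Finsupp.single n 1) = (q : ℂ) ^ (2 * n) • Finsupp.single n 1 := by
  simp only [y, map_sub, map_one, map_mul, T_z, T_zs, LinearMap.sub_apply, Module.End.one_apply,
    Module.End.mul_apply, lower_single, map_smul, raise_single]
  rcases n with _ | n
  · simp
  · simp [sub_smul]

/-! ### Distributions and finite functions -/

/-- The space `D(U)'_q` of distributions: the completion of `Pol(ℂ)_q` in the weakest topology in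
which all matrix elements of the operators `T(f)` are continuous.  A distribution `F` is given by
its infinite matrix `F m n`, the coefficient of `v_m` in `T(F) v_n`; the topology is that of
entrywise convergence.  In terms of the polar decomposition
`F = ∑_{m>0} z^m ψ_m(y) + ψ_0(y) + ∑_{m>0} ψ_{-m}(y) z*^m`, the diagonal entry `F n n` is
`ψ_0(q^{2n})`. -/
abbrev Dist : Type := ℕ → ℕ → ℂ

/-- The canonical map of `Pol(ℂ)_q` to `D(U)'_q`. -/
noncomputable def toDist (q : ℝ) : Pol q →ₗ[ℂ] Dist where
  toFun f m n := T q f (Finsupp.single n 1) m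
  map_add' f g := by ext m n; simp
  map_smul' c f := by ext m n; simp

/-- The vector space `D(U)_q` of finite functions: distributions whose matrix has only finitely
many non-zero entries. -/
def finFun : Submodule ℂ Dist where
  carrier := {F | {p : ℕ × ℕ | F p.1 p.2 ≠ 0}.Finite}
  zero_mem' := by simp
  add_mem' := by
    intro F G hF hG
    refine (hF.union hG).subset ?_
    intro p hp
    by_contra h
    simp only [Set.mem_union, Set.mem_ofPred_eq, not_or, not_not] at h
    exact hp (by simp [h.1, h.2])
  smul_mem' := by
    intro c F hF
    refine hF.subset ?_
    intro p hp h
    exact hp (by simp [h])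

/-- The product of distributions, as the product of infinite matrices.  It is used only when one
of the factors is finite, so that the sum has finitely many non-zero terms. -/
noncomputable def distMul (F G : Dist) : Dist := fun m n => ∑' k, F m k * G k n

/-- `(v_n, v_n) = (q²; q²)_n`, the scalar squares of the (pairwise orthogonal) basis vectors of the
pre-Hilbert space `H`. -/
noncomputable def poch (q : ℝ) (n : ℕ) : ℝ := ∏ j ∈ Finset.range n, (1 - q ^ (2 * (j + 1)))

/-- The involution `F ↦ F*`, for which `T(F*)` is the adjoint of `T(F)` with respect to the scalar
product of `H`: `(F*)_{mn} (v_m, v_m) = conj(F_{nm}) (v_n, v_n)`. -/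
noncomputable def dagger (q : ℝ) (F : Dist) : Dist :=
  fun m n => (starRingEnd ℂ) (F n m) * (poch q n : ℂ) / (poch q m : ℂ)

/-- The Lebesgue integral `μ(f) = (1 - q²) ∑_m ψ_0(q^{2m}) q^{2m}`. -/
noncomputable def mu (q : ℝ) (F : Dist) : ℂ :=
  (1 - (q : ℂ) ^ 2) * ∑' m : ℕ, F m m * (q : ℂ) ^ (2 * m)

/-- Right multiplication by `(1 - z z*)^{-2}`, where `1 - z z*` acts by `v_n ↦ q^{2n} v_n`. -/
noncomputable def mulYInvSq (q : ℝ) (F : Dist) : Dist :=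
  fun m n => F m n * (((q : ℂ) ^ (2 * n)) ^ 2)⁻¹

/-- The invariant integral `ν(f) = μ(f (1 - z z*)^{-2})`. -/
noncomputable def nu (q : ℝ) (F : Dist) : ℂ := mu q (mulYInvSq q F)

/-! ### The operator `∂̄` on functions -/

theorem q_ne (q : ℝ) [hq : Fact (0 < q ∧ q < 1)] : (q : ℂ) ≠ 0 := by
  exact_mod_cast hq.out.1.ne'

theorem one_sub_ne (q : ℝ) [hq : Fact (0 < q ∧ q < 1)] (n : ℕ) (hn : n ≠ 0) :
    (1 : ℂ) - (q : ℂ) ^ n ≠ 0 := by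
  have h := pow_lt_one₀ hq.out.1.le hq.out.2 hn
  rw [sub_ne_zero]
  exact_mod_cast h.ne'

theorem twist_rel (q : ℝ) [Fact (0 < q ∧ q < 1)] :
    (((q : ℂ) ^ 2)⁻¹ • zs q) * ((q : ℂ) ^ 2 • z q)
      = (q : ℂ) ^ 2 • (((q : ℂ) ^ 2 • z q) * (((q : ℂ) ^ 2)⁻¹ • zs q))
        + (1 - (q : ℂ) ^ 2) • (1 : Pol q) := by
  have h : ((q : ℂ) ^ 2) ≠ 0 := pow_ne_zero _ (q_ne q)
  simp only [smul_mul_smul_comm, mul_inv_cancel₀ h, inv_mul_cancel₀ h, one_smul]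
  exact zs_mul_z q

/-- The automorphism `σ` describing the bimodule of `(0,1)`-forms: `dz* · g = σ(g) · dz*`, that is,
`dz* · z = q² z · dz*` and `dz* · z* = q⁻² z* · dz*`. -/
noncomputable def twist (q : ℝ) [Fact (0 < q ∧ q < 1)] : Pol q →ₐ[ℂ] Pol q :=
  Pol.lift q ((q : ℂ) ^ 2 • z q) (((q : ℂ) ^ 2)⁻¹ • zs q) (twist_rel q)

/-- Functions together with `(0,1)`-forms: the homomorphism
`f ↦ !![f, g; 0, σ(f)]`, where `∂̄f = g dz*`. Multiplicativity is the Leibniz rule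
`∂̄(f₁ f₂) = (∂̄f₁) f₂ + f₁ (∂̄f₂)`; on generators, `∂̄z = 0` and `∂̄z* = dz*`. -/
noncomputable def dbarHom (q : ℝ) [Fact (0 < q ∧ q < 1)] :
    Pol q →ₐ[ℂ] Matrix (Fin 2) (Fin 2) (Pol q) :=
  Pol.lift q !![z q, 0; 0, twist q (z q)] !![zs q, 1; 0, twist q (zs q)] (by
    have h1 := twist_rel q
    have h2 := zs_mul_z q
    have h3 : twist q (z q) = (q : ℂ) ^ 2 • z q := Pol.lift_z ..
    have h4 : twist q (zs q) = ((q : ℂ) ^ 2)⁻¹ • zs q := Pol.lift_zs ..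
    rw [← h3, ← h4] at h1
    ext i j
    fin_cases i <;> fin_cases j
    · simp [Matrix.mul_apply, Fin.sum_univ_two, h2]
    · simp [Matrix.mul_apply, Fin.sum_univ_two, h3]
    · simp [Matrix.mul_apply, Fin.sum_univ_two]
    · simpa [Matrix.mul_apply, Fin.sum_univ_two] using h1)

/-- The operator `∂̄` on polynomials, through `∂̄f = (dbarPol f) dz*`. -/
noncomputable def dbarPol (q : ℝ) [Fact (0 < q ∧ q < 1)] : Pol q →ₗ[ℂ] Pol q where
  toFun f := dbarHom q f 0 1
  map_add' f g := by simp
  map_smul' c f := by simp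

theorem twist_z (q : ℝ) [Fact (0 < q ∧ q < 1)] : twist q (z q) = (q : ℂ) ^ 2 • z q :=
  Pol.lift_z ..

theorem twist_zs (q : ℝ) [Fact (0 < q ∧ q < 1)] : twist q (zs q) = ((q : ℂ) ^ 2)⁻¹ • zs q :=
  Pol.lift_zs ..

theorem dbarHom_z (q : ℝ) [Fact (0 < q ∧ q < 1)] :
    dbarHom q (z q) = !![z q, 0; 0, twist q (z q)] := Pol.lift_z ..

theorem dbarHom_zs (q : ℝ) [Fact (0 < q ∧ q < 1)] :
    dbarHom q (zs q) = !![zs q, 1; 0, twist q (zs q)] := Pol.lift_zs ..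

theorem dbarHom_entries (q : ℝ) [Fact (0 < q ∧ q < 1)] (f : Pol q) :
    dbarHom q f 0 0 = f ∧ dbarHom q f 1 0 = 0 ∧ dbarHom q f 1 1 = twist q f := by
  induction f using Pol.induction with
  | hs c => simp [AlgHom.commutes, Matrix.algebraMap_matrix_apply]
  | hz => simp [dbarHom_z]
  | hzs => simp [dbarHom_zs]
  | hadd f g hf hg => simp [hf, hg]
  | hmul f g hf hg => simp [Matrix.mul_apply, Fin.sum_univ_two, hf, hg]

theorem dbarPol_z (q : ℝ) [Fact (0 < q ∧ q < 1)] : dbarPol q (z q) = 0 := by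
  simp [dbarPol, dbarHom_z]

theorem dbarPol_zs (q : ℝ) [Fact (0 < q ∧ q < 1)] : dbarPol q (zs q) = 1 := by
  simp [dbarPol, dbarHom_zs]

/-- The Leibniz rule `∂̄(fg) = f ∂̄g + (∂̄f) g`. -/
theorem dbarPol_mul (q : ℝ) [Fact (0 < q ∧ q < 1)] (f g : Pol q) :
    dbarPol q (f * g) = f * dbarPol q g + dbarPol q f * twist q g := by
  simp [dbarPol, Matrix.mul_apply, Fin.sum_univ_two, dbarHom_entries]

theorem zs_mul_y (q : ℝ) : zs q * y q = (q : ℂ) ^ 2 • (y q * zs q) := by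
  have h := zs_mul_z q
  simp only [y, mul_sub, sub_mul, mul_one, one_mul, ← mul_assoc, h]
  simp only [add_mul, smul_mul_assoc, one_mul]
  module

theorem y_mul_z (q : ℝ) : y q * z q = (q : ℂ) ^ 2 • (z q * y q) := by
  have h := zs_mul_z q
  simp only [y, mul_sub, sub_mul, mul_one, one_mul, mul_assoc, h]
  simp only [mul_add, mul_smul_comm, mul_one]
  module

theorem twist_mul_y (q : ℝ) [Fact (0 < q ∧ q < 1)] (f : Pol q) :
    twist q f * y q = y q * f := by
  induction f using Pol.induction with
  | hs c => rw [AlgHom.commutes, Algebra.commutes]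
  | hz => rw [twist_z, smul_mul_assoc, ← y_mul_z]
  | hzs =>
    rw [twist_zs, smul_mul_assoc, zs_mul_y, smul_smul,
      inv_mul_cancel₀ (pow_ne_zero _ (q_ne q)), one_smul]
  | hadd f g hf hg => simp [add_mul, mul_add, hf, hg]
  | hmul f g hf hg => rw [map_mul, mul_assoc, hg, ← mul_assoc, hf, mul_assoc]

theorem dbarPol_mul_y (q : ℝ) [Fact (0 < q ∧ q < 1)] (f : Pol q) :
    (1 - (q : ℂ) ^ 2) • (dbarPol q f * y q) = f * z q - z q * f := by
  induction f using Pol.induction with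
  | hs c =>
    have h : dbarPol q (algebraMap ℂ (Pol q) c) = 0 := by
      simp [dbarPol, AlgHom.commutes, Matrix.algebraMap_matrix_apply]
    rw [h, Algebra.commutes]
    simp
  | hz => simp [dbarPol_z]
  | hzs =>
    rw [dbarPol_zs, zs_mul_z, one_mul, y]
    module
  | hadd f g hf hg =>
    rw [map_add, add_mul, smul_add, hf, hg, add_mul, mul_add]
    abel
  | hmul f g hf hg =>
    rw [dbarPol_mul, add_mul, smul_add, mul_assoc, mul_assoc, twist_mul_y, ← mul_assoc (dbarPol q f),
      ← mul_smul_comm, ← smul_mul_assoc (1 - (q : ℂ) ^ 2) (dbarPol q f * y q), hf, hg]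
    simp only [mul_sub, sub_mul, mul_assoc]
    abel

/-- The operator `∂̄` on distributions, through `∂̄F = (dbarDist F) dz*`: the unique extension by
continuity of `∂̄` from polynomials (see `dbarDist_toDist`, `continuous_dbarDist`,
`denseRange_toDist`).  In closed form, `∂̄F = (1 - q²)⁻¹ (F z - z F) (1 - z z*)⁻¹ dz*`. -/
noncomputable def dbarDist (q : ℝ) : Dist →ₗ[ℂ] Dist where
  toFun F m n := (1 - (q : ℂ) ^ 2)⁻¹ * ((q : ℂ) ^ (2 * n))⁻¹ *
    (F m (n + 1) - if m = 0 then 0 else F (m - 1) n)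
  map_add' F G := by
    ext m n
    simp only [Pi.add_apply]
    split_ifs <;> ring
  map_smul' c F := by
    ext m n
    simp only [Pi.smul_apply, smul_eq_mul, RingHom.id_apply]
    split_ifs <;> ring

theorem raise_apply (v : Fock) (m : ℕ) : raise v m = if m = 0 then 0 else v (m - 1) := by
  induction v using Finsupp.induction_linear with
  | zero => simp
  | add v w hv hw =>
    rw [map_add, Finsupp.add_apply, hv, hw]
    split_ifs <;> simp
  | single n c =>
    rw [← mul_one c, ← smul_eq_mul, ← Finsupp.smul_single, map_smul, raise_single]
    rcases m with _ | m
    · simp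
    · simp [Finsupp.single_apply]

theorem dbarDist_toDist (q : ℝ) [Fact (0 < q ∧ q < 1)] (f : Pol q) :
    dbarDist q (toDist q f) = toDist q (dbarPol q f) := by
  ext m n
  have h := congrArg (fun g => T q g (Finsupp.single n 1) m) (dbarPol_mul_y q f)
  simp only [map_smul, map_mul, map_sub, LinearMap.smul_apply, Module.End.mul_apply, T_y_single,
    LinearMap.sub_apply, T_z, raise_single, Finsupp.smul_apply, Finsupp.sub_apply, smul_eq_mul,
    raise_apply] at h
  simp only [dbarDist, toDist, LinearMap.coe_mk, AddHom.coe_mk]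
  rw [← h]
  have h1 := one_sub_ne q 2 (by norm_num)
  have h2 := pow_ne_zero (2 * n) (q_ne q)
  field_simp

theorem continuous_dbarDist (q : ℝ) : Continuous (dbarDist q) := by
  refine continuous_pi fun m => continuous_pi fun n => ?_
  simp only [dbarDist, LinearMap.coe_mk, AddHom.coe_mk]
  split_ifs <;> fun_prop

/-! ### Density of the polynomials among the distributions -/

theorem poch_pos (q : ℝ) [hq : Fact (0 < q ∧ q < 1)] (n : ℕ) : 0 < poch q n := by
  refine Finset.prod_pos fun j _ => ?_
  have := pow_lt_one₀ hq.out.1.le hq.out.2 (n := 2 * (j + 1)) (by omega)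
  linarith

theorem poch_succ (q : ℝ) (n : ℕ) : poch q (n + 1) = poch q n * (1 - q ^ (2 * (n + 1))) := by
  simp [poch, Finset.prod_range_succ]

theorem lower_pow_single (q : ℝ) (k j : ℕ) :
    (lower q ^ k) (Finsupp.single (k + j) 1)
      = ((∏ i ∈ Finset.range k, (1 - (q : ℂ) ^ (2 * (j + i + 1)))) • Finsupp.single j 1 : Fock) := by
  induction k with
  | zero => simp
  | succ k ih =>
    rw [pow_succ, Module.End.mul_apply, lower_single, map_smul,
      show k + 1 + j - 1 = k + j by omega, ih, smul_smul, Finset.prod_range_succ, mul_comm]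
    congr 4
    omega

theorem lower_pow_single_of_lt (q : ℝ) (k n : ℕ) (h : n < k) :
    (lower q ^ k) (Finsupp.single n 1 : Fock) = 0 := by
  obtain ⟨d, rfl⟩ := Nat.exists_eq_add_of_lt h
  rw [show n + d + 1 = d + (1 + n) by ring, pow_add, pow_add, Module.End.mul_apply,
    Module.End.mul_apply]
  have := lower_pow_single q n 0
  rw [add_zero] at this
  rw [this, map_smul, pow_one, lower_single]
  simp

theorem raise_pow_single (k n : ℕ) :
    (raise ^ k) (Finsupp.single n 1) = (Finsupp.single (n + k) 1 : Fock) := by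
  induction k with
  | zero => simp
  | succ k ih => rw [pow_succ', Module.End.mul_apply, ih, raise_single]; rfl

theorem exists_vacuum (q : ℝ) [hq : Fact (0 < q ∧ q < 1)] (N : ℕ) :
    ∃ p : Pol q, ∀ n < N, T q p (Finsupp.single n 1)
      = if n = 0 then (Finsupp.single n 1 : Fock) else 0 := by
  induction N with
  | zero => exact ⟨0, by simp⟩
  | succ N ih =>
    obtain ⟨p, hp⟩ := ih
    rcases N with _ | N
    · exact ⟨1, fun n hn => by simp [show n = 0 by omega]⟩
    · have h1 := one_sub_ne q (2 * (N + 1)) (by omega)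
      refine ⟨(1 - (q : ℂ) ^ (2 * (N + 1)))⁻¹ • (p * (y q - (q : ℂ) ^ (2 * (N + 1)) • 1)), ?_⟩
      intro n hn
      simp only [map_smul, map_mul, map_sub, LinearMap.smul_apply, Module.End.mul_apply,
        LinearMap.sub_apply, T_y_single, map_one, Module.End.one_apply, ← sub_smul]
      rcases Nat.lt_succ_iff_lt_or_eq.mp hn with hn | rfl
      · rw [hp n hn]
        split_ifs with h0
        · subst h0
          rw [smul_smul]
          simp [inv_mul_cancel₀ h1]
        · simp
      · simp

theorem exists_matrixUnit (q : ℝ) [hq : Fact (0 < q ∧ q < 1)] (N m n : ℕ) :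
    ∃ p : Pol q, ∀ k < N, ∀ j, toDist q p j k = if j = m ∧ k = n then 1 else 0 := by
  obtain ⟨p, hp⟩ := exists_vacuum q N
  set c : ℂ := ∏ i ∈ Finset.range n, (1 - (q : ℂ) ^ (2 * (0 + i + 1))) with hc
  have hc0 : c ≠ 0 := by
    refine Finset.prod_ne_zero_iff.mpr fun i _ => one_sub_ne q _ (by omega)
  refine ⟨c⁻¹ • (z q ^ m * p * zs q ^ n), fun k hk j => ?_⟩
  change T q (c⁻¹ • (z q ^ m * p * zs q ^ n)) (Finsupp.single k 1) j = _
  simp only [map_smul, map_mul, map_pow, T_z, T_zs, LinearMap.smul_apply, Module.End.mul_apply]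
  rcases lt_or_ge k n with h | h
  · rw [lower_pow_single_of_lt q n k h]
    simp [h.ne]
  · obtain ⟨d, rfl⟩ := Nat.exists_eq_add_of_le h
    rw [lower_pow_single, map_smul, hp d (by omega)]
    rcases Nat.eq_zero_or_pos d with rfl | hd
    · simp only [if_true, map_smul, raise_pow_single, ← hc, smul_smul, inv_mul_cancel₀ hc0]
      simp [Finsupp.single_apply, eq_comm]
    · simp [hd.ne']

theorem denseRange_toDist (q : ℝ) [hq : Fact (0 < q ∧ q < 1)] : DenseRange (toDist q) := by
  intro F
  choose p hp using fun N m n => exists_matrixUnit q N m n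
  refine mem_closure_of_tendsto (b := atTop) (f := fun N : ℕ => toDist q
    (∑ m ∈ Finset.range N, ∑ n ∈ Finset.range N, F m n • p N m n)) ?_
    (Eventually.of_forall fun N => ⟨_, rfl⟩)
  refine tendsto_pi_nhds.mpr fun j => tendsto_pi_nhds.mpr fun k => ?_
  refine tendsto_const_nhds.congr' ?_
  filter_upwards [eventually_gt_atTop (max j k)] with N hN
  have hj : j < N := lt_of_le_of_lt (le_max_left _ _) hN
  have hk : k < N := lt_of_le_of_lt (le_max_right _ _) hN
  simp only [map_sum, map_smul, Finset.sum_apply, Pi.smul_apply, smul_eq_mul, hp _ _ _ k hk]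
  rw [Finset.sum_eq_single j, Finset.sum_eq_single k]
  · simp
  · intro b _ hb; simp [hb.symm]
  · simp [hk]
  · intro b _ hb; simp [hb.symm]
  · simp [hj]

/-! ### Compatibility of the involution with that of `Pol(ℂ)_q`, and the module `H^op` -/

/-- The opposite ring of `Pol(ℂ)_q`, with complex scalars acting through conjugation. -/
def ConjOp (q : ℝ) : Type := (Pol q)ᵐᵒᵖ

noncomputable instance (q : ℝ) : Ring (ConjOp q) := inferInstanceAs (Ring (Pol q)ᵐᵒᵖ)

noncomputable instance (q : ℝ) : Algebra ℂ (ConjOp q) :=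
  RingHom.toAlgebra' ((algebraMap ℂ (Pol q)ᵐᵒᵖ).comp (starRingEnd ℂ))
    fun c x => Algebra.commutes (A := (Pol q)ᵐᵒᵖ) ((starRingEnd ℂ) c) x

/-- An element of `Pol(ℂ)_q`, regarded in the opposite ring. -/
def ConjOp.of (q : ℝ) (f : Pol q) : ConjOp q := (MulOpposite.op f : (Pol q)ᵐᵒᵖ)

theorem ConjOp.of_mul (q : ℝ) (f g : Pol q) : of q f * of q g = of q (g * f) := rfl

theorem ConjOp.of_add (q : ℝ) (f g : Pol q) : of q f + of q g = of q (f + g) := rfl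

theorem ConjOp.one_eq (q : ℝ) : (1 : ConjOp q) = of q 1 := rfl

theorem ConjOp.smul_of (q : ℝ) (c : ℂ) (f : Pol q) :
    c • of q f = of q ((starRingEnd ℂ) c • f) := by
  rw [Algebra.smul_def, Algebra.smul_def, Algebra.commutes]
  rfl

theorem starHom_rel (q : ℝ) :
    ConjOp.of q (z q) * ConjOp.of q (zs q)
      = (q : ℂ) ^ 2 • (ConjOp.of q (zs q) * ConjOp.of q (z q))
        + (1 - (q : ℂ) ^ 2) • (1 : ConjOp q) := by
  rw [ConjOp.one_eq, ConjOp.of_mul, ConjOp.of_mul, ConjOp.smul_of, ConjOp.smul_of, ConjOp.of_add,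
    zs_mul_z]
  simp

/-- The involution of `Pol(ℂ)_q`, as a conjugate-linear anti-homomorphism with `z ↦ z*`,
`z* ↦ z`. -/
noncomputable def starHom (q : ℝ) : Pol q →ₐ[ℂ] ConjOp q :=
  Pol.lift q (ConjOp.of q (zs q)) (ConjOp.of q (z q)) (starHom_rel q)

/-- The element `f*` of `Pol(ℂ)_q`. -/
noncomputable def starPol (q : ℝ) (f : Pol q) : Pol q :=
  MulOpposite.unop (starHom q f : (Pol q)ᵐᵒᵖ)

theorem starPol_algebraMap (q : ℝ) (c : ℂ) :
    starPol q (algebraMap ℂ (Pol q) c) = algebraMap ℂ (Pol q) ((starRingEnd ℂ) c) := by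
  unfold starPol
  rw [AlgHom.commutes]
  rfl

theorem starPol_z (q : ℝ) : starPol q (z q) = zs q := by
  unfold starPol starHom
  rw [Pol.lift_z]
  rfl

theorem starPol_zs (q : ℝ) : starPol q (zs q) = z q := by
  unfold starPol starHom
  rw [Pol.lift_zs]
  rfl

theorem starPol_add (q : ℝ) (f g : Pol q) : starPol q (f + g) = starPol q f + starPol q g := by
  unfold starPol
  rw [map_add]
  rfl

theorem starPol_mul (q : ℝ) (f g : Pol q) : starPol q (f * g) = starPol q g * starPol q f := by
  unfold starPol
  rw [map_mul]
  rfl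

/-- For `τ` the identity or the conjugation: the form `(v, w) ↦ ∑ τ(v_n) w_n (v_n, v_n)`. -/
noncomputable def fockForm (q : ℝ) (τ : ℂ →+* ℂ) (v w : Fock) : ℂ :=
  v.sum fun n a => τ a * w n * (poch q n : ℂ)

theorem fockForm_add (q : ℝ) (τ : ℂ →+* ℂ) (v v' w : Fock) :
    fockForm q τ (v + v') w = fockForm q τ v w + fockForm q τ v' w := by
  unfold fockForm
  rw [Finsupp.sum_add_index'] <;> intros <;> simp [add_mul]

theorem fockForm_single (q : ℝ) (τ : ℂ →+* ℂ) (n : ℕ) (c : ℂ) (w : Fock) :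
    fockForm q τ (Finsupp.single n c) w = τ c * w n * (poch q n : ℂ) := by
  simp [fockForm]

theorem fockForm_add_right (q : ℝ) (τ : ℂ →+* ℂ) (v w w' : Fock) :
    fockForm q τ v (w + w') = fockForm q τ v w + fockForm q τ v w' := by
  simp [fockForm, mul_add, add_mul, Finsupp.sum_add]

theorem fockForm_smul_right (q : ℝ) (τ : ℂ →+* ℂ) (c : ℂ) (v w : Fock) :
    fockForm q τ v (c • w) = c * fockForm q τ v w := by
  simp only [fockForm, Finsupp.smul_apply, smul_eq_mul, Finsupp.mul_sum]
  exact Finsupp.sum_congr fun n _ => by ring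

theorem fockForm_smul (q : ℝ) (τ : ℂ →+* ℂ) (c : ℂ) (v w : Fock) :
    fockForm q τ (c • v) w = τ c * fockForm q τ v w := by
  unfold fockForm
  rw [Finsupp.sum_smul_index (by simp)]
  simp only [Finsupp.mul_sum, map_mul]
  exact Finsupp.sum_congr fun n _ => by ring

theorem lower_apply (q : ℝ) (v : Fock) (m : ℕ) :
    lower q v m = (1 - (q : ℂ) ^ (2 * (m + 1))) * v (m + 1) := by
  induction v using Finsupp.induction_linear with
  | zero => simp
  | add v w hv hw => simp [hv, hw, mul_add]
  | single n c =>
    rw [← mul_one c, ← smul_eq_mul, ← Finsupp.smul_single, map_smul, lower_single]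
    rcases n with _ | n
    · simp
    · by_cases h : n = m
      · subst h; simp; ring
      · simp [h]

theorem fockForm_raise (q : ℝ) (τ : ℂ →+* ℂ) (v w : Fock) :
    fockForm q τ (raise v) w = fockForm q τ v (lower q w) := by
  induction v using Finsupp.induction_linear with
  | zero => simp [fockForm]
  | add v v' hv hv' => simp [fockForm_add, hv, hv']
  | single n c =>
    rw [← mul_one c, ← smul_eq_mul, ← Finsupp.smul_single, map_smul, raise_single, fockForm_smul,
      fockForm_smul, fockForm_single, fockForm_single, lower_apply, poch_succ]
    push_cast
    ring

theorem fockForm_lower (q : ℝ) (τ : ℂ →+* ℂ) (hτ : τ q = q) (v w : Fock) :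
    fockForm q τ (lower q v) w = fockForm q τ v (raise w) := by
  induction v using Finsupp.induction_linear with
  | zero => simp [fockForm]
  | add v v' hv hv' => simp [fockForm_add, hv, hv']
  | single n c =>
    rw [← mul_one c, ← smul_eq_mul, ← Finsupp.smul_single, map_smul, lower_single, fockForm_smul,
      fockForm_smul, fockForm_smul, fockForm_single, fockForm_single, raise_apply]
    rcases n with _ | n
    · simp
    · rw [if_neg (Nat.succ_ne_zero n)]
      simp only [Nat.add_sub_cancel, poch_succ, map_sub, map_one, map_pow, hτ]
      push_cast
      ring

/-- `T(f*)` is the adjoint of `T(f)`. -/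
theorem fockForm_T (q : ℝ) (f : Pol q) (v w : Fock) :
    fockForm q (starRingEnd ℂ) (T q f v) w
      = fockForm q (starRingEnd ℂ) v (T q (starPol q f) w) := by
  induction f using Pol.induction generalizing v w with
  | hs c =>
    rw [starPol_algebraMap, AlgHom.commutes, AlgHom.commutes, Module.algebraMap_end_apply,
      Module.algebraMap_end_apply, fockForm_smul, fockForm_smul_right]
  | hz => rw [starPol_z, T_z, T_zs, fockForm_raise]
  | hzs => rw [starPol_zs, T_z, T_zs, fockForm_lower _ _ (by simp)]
  | hadd f g hf hg => simp [starPol_add, fockForm_add, fockForm_add_right, hf, hg]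
  | hmul f g hf hg => simp [starPol_mul, hf, hg]

/-- The involution of distributions extends that of polynomials. -/
theorem dagger_toDist (q : ℝ) [Fact (0 < q ∧ q < 1)] (f : Pol q) :
    dagger q (toDist q f) = toDist q (starPol q f) := by
  ext m n
  have h := fockForm_T q f (Finsupp.single m 1) (Finsupp.single n 1)
  have hm : (poch q m : ℂ) ≠ 0 := by exact_mod_cast (poch_pos q m).ne'
  have h2 : fockForm q (starRingEnd ℂ) (T q f (Finsupp.single m 1)) (Finsupp.single n 1)
      = (starRingEnd ℂ) (T q f (Finsupp.single m 1) n) * (poch q n : ℂ) := by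
    generalize T q f (Finsupp.single m 1) = v
    induction v using Finsupp.induction_linear with
    | zero => simp [fockForm]
    | add v v' hv hv' => rw [fockForm_add, hv, hv']; simp [add_mul]
    | single k c =>
      rw [fockForm_single]
      by_cases hk : k = n
      · subst hk; simp
      · simp [hk]
  rw [h2, fockForm_single] at h
  change (starRingEnd ℂ) (T q f (Finsupp.single m 1) n) * (poch q n : ℂ) / (poch q m : ℂ)
    = T q (starPol q f) (Finsupp.single n 1) m
  rw [h]
  simp [hm]

theorem continuous_dagger (q : ℝ) : Continuous (dagger q) := by
  refine continuous_pi fun m => continuous_pi fun n => ?_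
  simp only [dagger]
  fun_prop

/-- The product of distributions extends that of polynomials. -/
theorem distMul_toDist (q : ℝ) (f g : Pol q) :
    distMul (toDist q f) (toDist q g) = toDist q (f * g) := by
  ext m n
  change ∑' k, T q f (Finsupp.single k 1) m * T q g (Finsupp.single n 1) k
    = T q (f * g) (Finsupp.single n 1) m
  rw [map_mul, Module.End.mul_apply]
  generalize T q g (Finsupp.single n 1) = v
  rw [tsum_eq_sum (s := v.support) (by
    intro k hk
    rw [Finsupp.notMem_support_iff.mp hk, mul_zero])]
  conv_rhs => rw [← Finsupp.sum_single v, Finsupp.sum, map_sum, Finsupp.finsetSum_apply]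
  refine Finset.sum_congr rfl fun k _ => ?_
  rw [show (Finsupp.single k (v k) : Fock) = v k • Finsupp.single k 1 by simp, map_smul]
  simp [mul_comm]

theorem TOp_rel (q : ℝ) :
    MulOpposite.op (raise) * MulOpposite.op (lower q)
      = (q : ℂ) ^ 2 • (MulOpposite.op (lower q) * MulOpposite.op (raise))
        + (1 - (q : ℂ) ^ 2) • (1 : (Module.End ℂ Fock)ᵐᵒᵖ) := by
  rw [← MulOpposite.op_mul, ← MulOpposite.op_mul, lower_raise]
  simp

/-- The representation of the opposite algebra of `Pol(ℂ)_q` in the module `H^op` with generator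
`v_0^op` and relation `z v_0^op = 0`; here `z*` acts by `v_n ↦ v_{n+1}` and `z` by
`v_n ↦ (1 - q^{2n}) v_{n-1}`. -/
noncomputable def TOp (q : ℝ) : Pol q →ₐ[ℂ] (Module.End ℂ Fock)ᵐᵒᵖ :=
  Pol.lift q (MulOpposite.op (lower q)) (MulOpposite.op raise) (TOp_rel q)

/-- The matrix elements in `H^op` are, up to non-zero constant factors and transposition, those
in `H`; so the two families define the same topology. -/
theorem TOp_entry (q : ℝ) (f : Pol q) (m n : ℕ) :
    (poch q m : ℂ) * (TOp q f).unop (Finsupp.single n 1) m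
      = (poch q n : ℂ) * toDist q f n m := by
  have key : ∀ v w : Fock, fockForm q (RingHom.id ℂ) v ((TOp q f).unop w)
      = fockForm q (RingHom.id ℂ) (T q f v) w := by
    induction f using Pol.induction with
    | hs c =>
      intro v w
      rw [AlgHom.commutes, AlgHom.commutes, MulOpposite.algebraMap_apply, MulOpposite.unop_op,
        Module.algebraMap_end_apply, Module.algebraMap_end_apply, fockForm_smul,
        fockForm_smul_right]
      rfl
    | hz =>
      intro v w
      rw [T_z, fockForm_raise, TOp, Pol.lift_z, MulOpposite.unop_op]
    | hzs =>
      intro v w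
      rw [T_zs, fockForm_lower _ _ (by simp), TOp, Pol.lift_zs, MulOpposite.unop_op]
    | hadd f g hf hg => intro v w; simp [fockForm_add, fockForm_add_right, hf, hg]
    | hmul f g hf hg => intro v w; simp [hf, hg]
  have h := key (Finsupp.single m 1) (Finsupp.single n 1)
  have h2 : fockForm q (RingHom.id ℂ) (T q f (Finsupp.single m 1)) (Finsupp.single n 1)
      = T q f (Finsupp.single m 1) n * (poch q n : ℂ) := by
    generalize T q f (Finsupp.single m 1) = v
    induction v using Finsupp.induction_linear with
    | zero => simp [fockForm]
    | add v v' hv hv' => rw [fockForm_add, hv, hv']; simp [add_mul]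
    | single k c =>
      rw [fockForm_single]
      by_cases hk : k = n
      · subst hk; simp
      · simp [hk]
  rw [h2, fockForm_single] at h
  simp only [map_one, one_mul] at h
  rw [mul_comm, h, mul_comm]
  rfl

/-! ### The Hilbert spaces `L²(dν)_q` and `L²(dμ)_q` -/

theorem exists_bound {F : Dist} (hF : F ∈ finFun) :
    ∃ N : ℕ, ∀ m n, F m n ≠ 0 → m < N ∧ n < N := by
  have hF' : {p : ℕ × ℕ | F p.1 p.2 ≠ 0}.Finite := hF
  obtain ⟨⟨a, b⟩, h⟩ := hF'.bddAbove
  refine ⟨a + b + 1, fun m n hmn => ?_⟩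
  have := h (a := (m, n)) hmn
  have h1 : m ≤ a := this.1
  have h2 : n ≤ b := this.2
  omega

/-- A common expression for the integrals `μ` and `ν`. -/
noncomputable def wInt (w : ℕ → ℝ) (F : Dist) : ℂ := ∑' n : ℕ, F n n * (w n : ℂ)

theorem mu_eq_wInt (q : ℝ) (F : Dist) :
    mu q F = wInt (fun n => (1 - q ^ 2) * q ^ (2 * n)) F := by
  simp only [mu, wInt, ← tsum_mul_left]
  refine tsum_congr fun n => ?_
  push_cast
  ring

theorem nu_eq_wInt (q : ℝ) (F : Dist) :
    nu q F = wInt (fun n => (1 - q ^ 2) * ((((q ^ (2 * n)) ^ 2)⁻¹) * q ^ (2 * n))) F := by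
  simp only [nu, mulYInvSq, mu, wInt, ← tsum_mul_left]
  refine tsum_congr fun n => ?_
  push_cast
  ring

theorem mu_weight_pos (q : ℝ) [hq : Fact (0 < q ∧ q < 1)] (n : ℕ) :
    0 < (1 - q ^ 2) * q ^ (2 * n) := by
  have h0 := hq.out.1
  have := pow_lt_one₀ h0.le hq.out.2 (n := 2) (by norm_num)
  exact mul_pos (by linarith) (by positivity)

theorem nu_weight_pos (q : ℝ) [hq : Fact (0 < q ∧ q < 1)] (n : ℕ) :
    0 < (1 - q ^ 2) * ((((q ^ (2 * n)) ^ 2)⁻¹) * q ^ (2 * n)) := by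
  have h0 := hq.out.1
  have := pow_lt_one₀ h0.le hq.out.2 (n := 2) (by norm_num)
  exact mul_pos (by linarith) (by positivity)

theorem wInt_eq (q : ℝ) (w : ℕ → ℝ) (F G : Dist) (N : ℕ)
    (hN : ∀ m n, F m n ≠ 0 → m < N ∧ n < N) :
    wInt w (distMul (dagger q F) G) = ∑ n ∈ Finset.range N, ∑ k ∈ Finset.range N,
      (starRingEnd ℂ) (F k n) * G k n * ((poch q k / poch q n * w n : ℝ) : ℂ) := by
  have h0 : ∀ m n, ¬ (m < N ∧ n < N) → F m n = 0 := fun m n h => by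
    by_contra h'
    exact h (hN m n h')
  rw [wInt, tsum_eq_sum (s := Finset.range N)]
  · refine Finset.sum_congr rfl fun n _ => ?_
    rw [distMul, tsum_eq_sum (s := Finset.range N)]
    · rw [Finset.sum_mul]
      refine Finset.sum_congr rfl fun k _ => ?_
      simp only [dagger]
      push_cast
      ring
    · intro k hk
      simp [dagger, h0 k n (fun h => hk (Finset.mem_range.mpr h.1))]
  · intro n hn
    have : ∀ k, F k n = 0 := fun k => h0 k n (fun h => hn (Finset.mem_range.mpr h.2))
    simp [distMul, dagger, this]

theorem wInt_conj (q : ℝ) (w : ℕ → ℝ) {F G : Dist} (hF : F ∈ finFun) (hG : G ∈ finFun) :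
    (starRingEnd ℂ) (wInt w (distMul (dagger q G) F)) = wInt w (distMul (dagger q F) G) := by
  obtain ⟨N, hN⟩ := exists_bound hF
  obtain ⟨M, hM⟩ := exists_bound hG
  rw [wInt_eq q w F G (N + M) (fun m n h => by have := hN m n h; omega),
    wInt_eq q w G F (N + M) (fun m n h => by have := hM m n h; omega)]
  simp only [map_sum, map_mul, Complex.conj_conj, Complex.conj_ofReal]
  refine Finset.sum_congr rfl fun n _ => Finset.sum_congr rfl fun k _ => by ring

theorem wInt_add (q : ℝ) (w : ℕ → ℝ) {F F' : Dist} (hF : F ∈ finFun) (hF' : F' ∈ finFun)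
    (G : Dist) :
    wInt w (distMul (dagger q (F + F')) G)
      = wInt w (distMul (dagger q F) G) + wInt w (distMul (dagger q F') G) := by
  obtain ⟨N, hN⟩ := exists_bound hF
  obtain ⟨M, hM⟩ := exists_bound hF'
  obtain ⟨L, hL⟩ := exists_bound (finFun.add_mem hF hF')
  rw [wInt_eq q w F G (N + M + L) (fun m n h => by have := hN m n h; omega),
    wInt_eq q w F' G (N + M + L) (fun m n h => by have := hM m n h; omega),
    wInt_eq q w (F + F') G (N + M + L) (fun m n h => by have := hL m n h; omega)]
  simp only [← Finset.sum_add_distrib]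
  refine Finset.sum_congr rfl fun n _ => Finset.sum_congr rfl fun k _ => ?_
  simp only [Pi.add_apply, map_add]
  ring

theorem wInt_smul (q : ℝ) (w : ℕ → ℝ) {F : Dist} (hF : F ∈ finFun) (G : Dist) (c : ℂ) :
    wInt w (distMul (dagger q (c • F)) G)
      = (starRingEnd ℂ) c * wInt w (distMul (dagger q F) G) := by
  obtain ⟨N, hN⟩ := exists_bound hF
  obtain ⟨M, hM⟩ := exists_bound (finFun.smul_mem c hF)
  rw [wInt_eq q w F G (N + M) (fun m n h => by have := hN m n h; omega),
    wInt_eq q w (c • F) G (N + M) (fun m n h => by have := hM m n h; omega)]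
  simp only [Finset.mul_sum]
  refine Finset.sum_congr rfl fun n _ => Finset.sum_congr rfl fun k _ => ?_
  simp only [Pi.smul_apply, smul_eq_mul, map_mul]
  ring

theorem wInt_self (q : ℝ) (w : ℕ → ℝ) (F : Dist) (N : ℕ)
    (hN : ∀ m n, F m n ≠ 0 → m < N ∧ n < N) :
    wInt w (distMul (dagger q F) F) = ((∑ n ∈ Finset.range N, ∑ k ∈ Finset.range N,
      ‖F k n‖ ^ 2 * (poch q k / poch q n * w n) : ℝ) : ℂ) := by
  rw [wInt_eq q w F F N hN]
  push_cast
  refine Finset.sum_congr rfl fun n _ => Finset.sum_congr rfl fun k _ => ?_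
  rw [Complex.conj_mul']

theorem wInt_nonneg (q : ℝ) [Fact (0 < q ∧ q < 1)] (w : ℕ → ℝ) (hw : ∀ n, 0 < w n) {F : Dist}
    (hF : F ∈ finFun) : 0 ≤ (wInt w (distMul (dagger q F) F)).re := by
  obtain ⟨N, hN⟩ := exists_bound hF
  rw [wInt_self q w F N hN, Complex.ofReal_re]
  refine Finset.sum_nonneg fun n _ => Finset.sum_nonneg fun k _ => ?_
  have h1 := poch_pos q k
  have h2 := poch_pos q n
  have h3 := hw n
  positivity

theorem wInt_definite (q : ℝ) [Fact (0 < q ∧ q < 1)] (w : ℕ → ℝ) (hw : ∀ n, 0 < w n) {F : Dist}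
    (hF : F ∈ finFun) (h : wInt w (distMul (dagger q F) F) = 0) : F = 0 := by
  obtain ⟨N, hN⟩ := exists_bound hF
  rw [wInt_self q w F N hN, Complex.ofReal_eq_zero] at h
  have hpos : ∀ n k, 0 < poch q k / poch q n * w n := fun n k =>
    mul_pos (div_pos (poch_pos q k) (poch_pos q n)) (hw n)
  ext k n
  by_contra hne
  obtain ⟨hk, hn⟩ := hN k n hne
  rw [Finset.sum_eq_zero_iff_of_nonneg (fun n _ => Finset.sum_nonneg fun k _ =>
    mul_nonneg (by positivity) (hpos n k).le)] at h
  have h' := h n (Finset.mem_range.mpr hn)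
  rw [Finset.sum_eq_zero_iff_of_nonneg (fun k _ => mul_nonneg (by positivity) (hpos n k).le)] at h'
  have h'' := h' k (Finset.mem_range.mpr hk)
  rcases mul_eq_zero.mp h'' with h3 | h3
  · exact hne (by simpa using h3)
  · exact (hpos n k).ne' h3

/-- The space `D(U)_q` of finite functions with the scalar product `∫ f₂* f₁ dν`. -/
def FinNu (_q : ℝ) : Type := finFun

/-- The space `Ω(U)_q^{(0,1)}` of `(0,1)`-forms `f dz*` with finite coefficients (the form `f dz*`
is represented by `f`), with the scalar product `∫ f₂* f₁ dμ`. -/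
def FinMu (_q : ℝ) : Type := finFun

noncomputable instance (q : ℝ) : AddCommGroup (FinNu q) := inferInstanceAs (AddCommGroup finFun)

noncomputable instance (q : ℝ) : Module ℂ (FinNu q) := inferInstanceAs (Module ℂ finFun)

noncomputable instance (q : ℝ) : AddCommGroup (FinMu q) := inferInstanceAs (AddCommGroup finFun)

noncomputable instance (q : ℝ) : Module ℂ (FinMu q) := inferInstanceAs (Module ℂ finFun)

/-- A finite function, as a distribution. -/
def FinNu.toDist {q : ℝ} (f : FinNu q) : Dist := f.1

/-- The coefficient `f` of a form `f dz*`, as a distribution. -/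
def FinMu.toDist {q : ℝ} (f : FinMu q) : Dist := f.1

/-- The scalar product `(f₁, f₂) = ∫ f₂* f₁ dν` of finite functions (in the convention of the
library, which is linear in the second argument: `inner f₁ f₂ = ∫ f₁* f₂ dν`). -/
@[reducible] noncomputable def coreNu (q : ℝ) [Fact (0 < q ∧ q < 1)] : InnerProductSpace.Core ℂ (FinNu q) where
  inner f g := nu q (distMul (dagger q f.toDist) g.toDist)
  conj_inner_symm f g := by
    simp only [nu_eq_wInt]
    exact wInt_conj q _ f.2 g.2
  re_inner_nonneg f := by
    simp only [nu_eq_wInt]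
    exact wInt_nonneg q _ (nu_weight_pos q) f.2
  add_left f f' g := by
    simp only [nu_eq_wInt]
    exact wInt_add q _ f.2 f'.2 _
  smul_left f g c := by
    simp only [nu_eq_wInt]
    exact wInt_smul q _ f.2 _ c
  definite f h := by
    simp only [nu_eq_wInt] at h
    exact Subtype.ext (wInt_definite q _ (nu_weight_pos q) f.2 h)

/-- The scalar product `(f₁ dz*, f₂ dz*) = ∫ f₂* f₁ dμ` of `(0,1)`-forms. -/
@[reducible] noncomputable def coreMu (q : ℝ) [Fact (0 < q ∧ q < 1)] : InnerProductSpace.Core ℂ (FinMu q) where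
  inner f g := mu q (distMul (dagger q f.toDist) g.toDist)
  conj_inner_symm f g := by
    simp only [mu_eq_wInt]
    exact wInt_conj q _ f.2 g.2
  re_inner_nonneg f := by
    simp only [mu_eq_wInt]
    exact wInt_nonneg q _ (mu_weight_pos q) f.2
  add_left f f' g := by
    simp only [mu_eq_wInt]
    exact wInt_add q _ f.2 f'.2 _
  smul_left f g c := by
    simp only [mu_eq_wInt]
    exact wInt_smul q _ f.2 _ c
  definite f h := by
    simp only [mu_eq_wInt] at h
    exact Subtype.ext (wInt_definite q _ (mu_weight_pos q) f.2 h)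

noncomputable instance (q : ℝ) [Fact (0 < q ∧ q < 1)] : NormedAddCommGroup (FinNu q) :=
  (coreNu q).toNormedAddCommGroup

noncomputable instance (q : ℝ) [Fact (0 < q ∧ q < 1)] : InnerProductSpace ℂ (FinNu q) :=
  InnerProductSpace.ofCore (coreNu q).toCore

noncomputable instance (q : ℝ) [Fact (0 < q ∧ q < 1)] : NormedAddCommGroup (FinMu q) :=
  (coreMu q).toNormedAddCommGroup

noncomputable instance (q : ℝ) [Fact (0 < q ∧ q < 1)] : InnerProductSpace ℂ (FinMu q) :=
  InnerProductSpace.ofCore (coreMu q).toCore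

/-- The Hilbert space `L²(dν)_q`, the completion of the space of finite functions. -/
abbrev L2Nu (q : ℝ) [Fact (0 < q ∧ q < 1)] : Type := UniformSpace.Completion (FinNu q)

/-- The Hilbert space `L²(dμ)_q`, the completion of the space of finite `(0,1)`-forms. -/
abbrev L2Mu (q : ℝ) [Fact (0 < q ∧ q < 1)] : Type := UniformSpace.Completion (FinMu q)

theorem dbarDist_mem (q : ℝ) {F : Dist} (hF : F ∈ finFun) : dbarDist q F ∈ finFun := by
  obtain ⟨N, hN⟩ := exists_bound hF
  refine (((Set.finite_lt_nat (N + 1)).prod (Set.finite_lt_nat (N + 1)))).subset ?_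
  rintro ⟨m, n⟩ h
  by_contra hmn
  apply h
  have h1 : F m (n + 1) = 0 := by
    by_contra h'
    have := hN _ _ h'
    exact hmn ⟨by simp; omega, by simp; omega⟩
  have h2 : m ≠ 0 → F (m - 1) n = 0 := by
    intro hm
    by_contra h'
    have := hN _ _ h'
    exact hmn ⟨by simp; omega, by simp; omega⟩
  simp only [dbarDist, LinearMap.coe_mk, AddHom.coe_mk, h1]
  split_ifs with hm
  · simp
  · simp [h2 hm]

/-- The operator `∂̄` from finite functions to finite `(0,1)`-forms. -/
noncomputable def dbarFin (q : ℝ) : FinNu q →ₗ[ℂ] FinMu q where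
  toFun f := ⟨dbarDist q f.toDist, dbarDist_mem q f.2⟩
  map_add' f g := Subtype.ext ((dbarDist q).map_add f.1 g.1)
  map_smul' c f := Subtype.ext ((dbarDist q).map_smul c f.1)

/-- The matrix unit with the entry `1` at the place `(m, n)`, a finite function. -/
def matrixUnit (q : ℝ) (m n : ℕ) : FinNu q :=
  ⟨fun j k => if j = m ∧ k = n then 1 else 0, by
    refine (Set.finite_singleton (m, n)).subset ?_
    rintro ⟨j, k⟩ h
    by_contra h'
    exact h (if_neg fun h'' => h' (Prod.ext h''.1 h''.2))⟩

/-- The canonical map of `L²(dν)_q` to `D(U)'_q`, the extension by continuity of the inclusion of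
`D(U)_q` (see `l2ToDist_coe`, `continuous_l2ToDist`).  The matrix entries are recovered from
scalar products with the (pairwise orthogonal) matrix units. -/
noncomputable def l2ToDist (q : ℝ) [Fact (0 < q ∧ q < 1)] (u : L2Nu q) : Dist :=
  fun m n => inner ℂ (matrixUnit q m n : L2Nu q) u
    / inner ℂ (matrixUnit q m n : L2Nu q) (matrixUnit q m n : L2Nu q)

theorem inner_matrixUnit (q : ℝ) [Fact (0 < q ∧ q < 1)] (m n : ℕ) :
    ∃ c : ℂ, c ≠ 0 ∧ ∀ f : FinNu q,
      inner ℂ (matrixUnit q m n : L2Nu q) (f : L2Nu q) = f.toDist m n * c := by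
  refine ⟨((poch q m / poch q n *
    ((1 - q ^ 2) * ((((q ^ (2 * n)) ^ 2)⁻¹) * q ^ (2 * n))) : ℝ) : ℂ), ?_, fun f => ?_⟩
  · rw [Complex.ofReal_ne_zero]
    exact (mul_pos (div_pos (poch_pos q m) (poch_pos q n)) (nu_weight_pos q n)).ne'
  · rw [UniformSpace.Completion.inner_coe]
    change nu q (distMul (dagger q (matrixUnit q m n).toDist) f.toDist) = _
    rw [nu_eq_wInt, wInt_eq q _ _ _ (m + n + 1), Finset.sum_eq_single n, Finset.sum_eq_single m]
    · simp only [matrixUnit, FinNu.toDist, and_self, if_true, map_one, one_mul]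
    · intro k _ hk
      simp [matrixUnit, FinNu.toDist, hk]
    · intro h
      exact absurd (Finset.mem_range.mpr (by omega)) h
    · intro k _ hk
      simp [matrixUnit, FinNu.toDist, hk]
    · intro h
      exact absurd (Finset.mem_range.mpr (by omega)) h
    · intro j k h
      have : j = m ∧ k = n := by
        by_contra h'
        exact h (if_neg h')
      omega

theorem l2ToDist_coe (q : ℝ) [Fact (0 < q ∧ q < 1)] (f : FinNu q) :
    l2ToDist q f = f.toDist := by
  ext m n
  obtain ⟨c, hc, h⟩ := inner_matrixUnit q m n
  rw [l2ToDist, h, h]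
  have : (matrixUnit q m n).toDist m n = 1 := if_pos ⟨rfl, rfl⟩
  rw [this]
  field_simp

/-- Elements of `L²(dν)_q` are determined by the distributions they define. -/
theorem l2ToDist_injective (q : ℝ) [Fact (0 < q ∧ q < 1)] : Function.Injective (l2ToDist q) := by
  intro u v huv
  have h0 : ∀ m n, inner ℂ (matrixUnit q m n : L2Nu q) (u - v) = 0 := by
    intro m n
    obtain ⟨c, hc, h⟩ := inner_matrixUnit q m n
    have h1 := congrFun (congrFun huv m) n
    have h2 : inner ℂ (matrixUnit q m n : L2Nu q) (matrixUnit q m n : L2Nu q) ≠ 0 := by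
      rw [h]
      have : (matrixUnit q m n).toDist m n = 1 := if_pos ⟨rfl, rfl⟩
      rwa [this, one_mul]
    rw [l2ToDist, l2ToDist, div_left_inj' h2] at h1
    rw [inner_sub_right, h1, sub_self]
  have h1 : ∀ f : FinNu q, inner ℂ (f : L2Nu q) (u - v) = 0 := by
    intro f
    obtain ⟨N, hN⟩ := exists_bound f.2
    have hf : f = ∑ m ∈ Finset.range N, ∑ n ∈ Finset.range N, f.toDist m n • matrixUnit q m n := by
      have hsum : ∀ (s : Finset ℕ) (g : ℕ → FinNu q),
          (∑ i ∈ s, g i).toDist = ∑ i ∈ s, (g i).toDist := fun s g =>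
        map_sum finFun.subtype g s
      have hsmul : ∀ (c : ℂ) (g : FinNu q), (c • g).toDist = c • g.toDist := fun c g => rfl
      refine Subtype.ext ?_
      change f.toDist = (∑ m ∈ Finset.range N, ∑ n ∈ Finset.range N,
        f.toDist m n • matrixUnit q m n).toDist
      ext j k
      simp only [hsum, hsmul, Finset.sum_apply, Pi.smul_apply, smul_eq_mul]
      have hE : ∀ m n, (matrixUnit q m n).toDist j k = if j = m ∧ k = n then 1 else 0 :=
        fun m n => rfl
      simp only [hE, mul_ite, mul_one, mul_zero, ite_and, Finset.sum_ite_irrel,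
        Finset.sum_const_zero, Finset.sum_ite_eq, Finset.mem_range]
      by_cases hjk : f.toDist j k = 0
      · simp [hjk]
      · simp [(hN j k hjk).1, (hN j k hjk).2]
    rw [hf]
    change inner ℂ (UniformSpace.Completion.toComplL (𝕜 := ℂ) _) (u - v) = 0
    simp only [map_sum, map_smul, sum_inner, inner_smul_left]
    refine Finset.sum_eq_zero fun m _ => Finset.sum_eq_zero fun n _ => ?_
    rw [mul_eq_zero]
    exact Or.inr (h0 m n)
  have h2 : ∀ w : L2Nu q, inner ℂ w (u - v) = 0 := by
    intro w
    refine UniformSpace.Completion.induction_on w (isClosed_eq (by fun_prop) continuous_const) h1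
  exact sub_eq_zero.mp (inner_self_eq_zero.mp (h2 _))

theorem continuous_l2ToDist (q : ℝ) [Fact (0 < q ∧ q < 1)] :
    Continuous (l2ToDist q) := by
  refine continuous_pi fun m => continuous_pi fun n => ?_
  unfold l2ToDist
  fun_prop

/-! ### Distributions on the product of two quantum discs, and the kernels -/

/-- The algebra `Pol(ℂ)_q^op ⊗ Pol(ℂ)_q`. -/
abbrev PolPair (q : ℝ) : Type := (Pol q)ᵐᵒᵖ ⊗[ℂ] Pol q

/-- The space `D(U × U)'_q`: the completion of `Pol(ℂ)_q^op ⊗ Pol(ℂ)_q` in the topology defined by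
the matrix elements in both factors.  The entry `K m n k l` is the value of the tensor product of
the matrix elements `(m, n)` in the first and `(k, l)` in the second factor; see `TOp_entry` for the
matrix elements of the first factor in the module `H^op`. -/
abbrev Dist₂ : Type := ℕ → ℕ → Dist

/-- The matrix element `(m, n)` as a linear functional on `Pol(ℂ)_q`. -/
noncomputable def entry (q : ℝ) (m n : ℕ) : Pol q →ₗ[ℂ] ℂ :=
  LinearMap.proj n ∘ₗ LinearMap.proj m ∘ₗ toDist q

/-- The canonical map of `Pol(ℂ)_q^op ⊗ Pol(ℂ)_q` to `D(U × U)'_q`. -/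
noncomputable def toDist₂ (q : ℝ) : PolPair q →ₗ[ℂ] Dist₂ :=
  LinearMap.pi fun m => LinearMap.pi fun n => LinearMap.pi fun k => LinearMap.pi fun l =>
    LinearMap.mul' ℂ ℂ ∘ₗ TensorProduct.map
      (entry q m n ∘ₗ (MulOpposite.opLinearEquiv ℂ).symm.toLinearMap) (entry q k l)

theorem toDist₂_tmul (q : ℝ) (f g : Pol q) (m n k l : ℕ) :
    toDist₂ q (MulOpposite.op f ⊗ₜ g) m n k l = toDist q f m n * toDist q g k l := by
  simp [toDist₂, entry]

theorem denseRange_toDist₂ (q : ℝ) [hq : Fact (0 < q ∧ q < 1)] : DenseRange (toDist₂ q) := by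
  intro K
  choose p hp using fun N m n => exists_matrixUnit q N m n
  refine mem_closure_of_tendsto (b := atTop) (f := fun N : ℕ => toDist₂ q
    (∑ a ∈ Finset.range N ×ˢ Finset.range N, ∑ b ∈ Finset.range N ×ˢ Finset.range N,
      K a.1 a.2 b.1 b.2 • (MulOpposite.op (p N a.1 a.2) ⊗ₜ[ℂ] p N b.1 b.2))) ?_
    (Eventually.of_forall fun N => ⟨_, rfl⟩)
  refine tendsto_pi_nhds.mpr fun m => tendsto_pi_nhds.mpr fun n => tendsto_pi_nhds.mpr fun k =>
    tendsto_pi_nhds.mpr fun l => ?_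
  refine tendsto_const_nhds.congr' ?_
  filter_upwards [eventually_gt_atTop (m + n + k + l)] with N hN
  have hm : m < N := by omega
  have hn : n < N := by omega
  have hk : k < N := by omega
  have hl : l < N := by omega
  simp only [map_sum, map_smul, Finset.sum_apply, Pi.smul_apply, smul_eq_mul, toDist₂_tmul,
    hp _ _ _ n hn, hp _ _ _ l hl]
  rw [Finset.sum_eq_single (m, n), Finset.sum_eq_single (k, l)]
  · simp
  · rintro ⟨a, b⟩ _ h
    have : ¬ (k = a ∧ l = b) := fun h' => h (by rw [h'.1, h'.2])
    simp [this]
  · simp [hk, hl]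
  · rintro ⟨a, b⟩ _ h
    have : ¬ (m = a ∧ n = b) := fun h' => h (by rw [h'.1, h'.2])
    simp [this]
  · simp [hm, hn]

/-- The integral operator with kernel `K` with respect to `ν`:
`f ↦ (id ⊗ ν)(K (1 ⊗ f)) = ∫ K(z, ζ) f(ζ) dν`. -/
noncomputable def intOp (q : ℝ) (K : Dist₂) (f : Dist) : Dist :=
  fun m n => nu q (distMul (K m n) f)

/-- The element `z ⊗ 1`. -/
noncomputable def zL (q : ℝ) : PolPair q := MulOpposite.op (z q) ⊗ₜ 1

/-- The element `z* ⊗ 1`. -/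
noncomputable def zsL (q : ℝ) : PolPair q := MulOpposite.op (zs q) ⊗ₜ 1

/-- The element `ζ = 1 ⊗ z`. -/
noncomputable def ζ (q : ℝ) : PolPair q := 1 ⊗ₜ z q

/-- The element `ζ* = 1 ⊗ z*`. -/
noncomputable def ζs (q : ℝ) : PolPair q := 1 ⊗ₜ zs q

/-- The polynomial kernel obtained from
`{((1 - ζζ*)(1 - z*ζ)⁻¹)^m ((1 - z*z)(1 - zζ*)⁻¹)^m}` by truncating the geometric series
`(1 - z*ζ)⁻¹ = ∑_i (z*ζ)^i` and `(1 - zζ*)⁻¹ = ∑_j (zζ*)^j` after `N` terms.  All products are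
those of the algebra `Pol(ℂ)_q^op ⊗ Pol(ℂ)_q`. -/
noncomputable def truncG (q : ℝ) (m N : ℕ) : PolPair q :=
  ((1 - ζ q * ζs q) * ∑ i ∈ Finset.range N, (zsL q * ζ q) ^ i) ^ m *
    ((1 - zsL q * zL q) * ∑ j ∈ Finset.range N, (zL q * ζs q) ^ j) ^ m

/-- The generalized kernel `G_m = {((1 - ζζ*)(1 - z*ζ)⁻¹)^m ((1 - z*z)(1 - zζ*)⁻¹)^m}`, the limit
in `D(U × U)'_q` of the truncated kernels. -/
noncomputable def G (q : ℝ) (m : ℕ) : Dist₂ := limUnder atTop fun N => toDist₂ q (truncG q m N)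

/-- The term with index `m` of the series for the Green function. -/
noncomputable def greenTerm (q : ℝ) (m : ℕ) : Dist₂ :=
  (((q ^ 2)⁻¹ - 1) / ((q ^ (2 * m))⁻¹ - 1) : ℝ) • G q m

/-- The Green function `G = -∑_{m ≥ 1} (q⁻² - 1)/(q^{-2m} - 1) G_m`. -/
noncomputable def green (q : ℝ) : Dist₂ := -∑' m : ℕ, greenTerm q (m + 1)

end QDisc

/-! Write `t = q²`. In matrix elements, `∂̄* ∂̄` is, up to the factor `(1 - t)²`, the operator
`lap`, a three-term difference operator acting separately along each diagonal `m - n = const`. The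
equation `□u = f` thus reads `lap u = -(1 - t)² f`. It suffices that the integral of `f` against `G`
solves this equation, and that solutions are unique among matrices tending to zero along every
diagonal.

Solution. Moving `y` through the geometric series by `y z = t z y` turns powers of these series into
q-binomial series, and `G_r` becomes the sum over `i, j` of `t^i c_i c_j (z^j y^r z*^i) ⊗ (ζ^i y^r
ζ*^j)` with `c_i = (t^r; t)_i / (t; t)_i` (`truncG_eq`, `toDist₂_truncG`). In this form `lap`,
applied in the first variable, maps `G_{s+1}` to a combination of `G_{s+2}` and `G_{s+1}`
(`lap_kernelEntry`). The coefficients in the Green function are exactly those that make the sum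
telescope. What remains is the limit of `G_r` for `r → ∞`: there `y^r` tends to the projection onto
`v_0`, and `G_r` tends to a multiple of the kernel of the identity operator (`tendsto_kernelEntry`).
This gives `lap_green`.

Uniqueness. Along a diagonal, a solution of the homogeneous equation is a multiple of its first
entry with real factors at least 1, so it cannot decay unless it vanishes
(`eq_zero_of_lap_eq_zero`). Both candidates do decay: the integral because of a bound on the kernels
uniform in `r` (`tendsto_green_diag`), the element of `L²(dν)_q` because the weights of its norm
grow like `t^{-n}` (`tendsto_l2ToDist_diag`).

Invertibility. The ratios `(v_m, v_m) / (v_n, v_n)` are bounded above and below, so both norms are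
comparable to weighted `ℓ²` norms. There `∂̄` becomes the difference of a shift of norm at most `q`
and an isometric shift. Hence it is bounded and bounded below (`norm_dbarFin_bounds`), and `□` is
invertible by coercivity. -/

namespace QDisc

/-! ### Coefficients and matrix elements of monomials -/

/-- The `q`-Pochhammer symbol `(t; t)_n`. -/
noncomputable def qPoch (t : ℂ) (n : ℕ) : ℂ := ∏ j ∈ Finset.range n, (1 - t ^ (j + 1))

/-- The coefficients `(t^r; t)_n / (t; t)_n` of the `q`-binomial series. -/
noncomputable def qBinom (t : ℂ) (r n : ℕ) : ℂ :=
  (∏ j ∈ Finset.range n, (1 - t ^ (r + j))) / qPoch t n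

/-- The matrix elements of `z^j y^r z*^i`, with `t = q²`. -/
noncomputable def monoEntry (t : ℂ) (j i r : ℕ) : Dist := fun m n =>
  if m + i = n + j ∧ i ≤ n then qPoch t n / qPoch t (n - i) * t ^ (r * (n - i)) else 0

/-- The positive operator `(1 - t)² ∂̄* ∂̄`, in matrix elements. -/
noncomputable def lap (t : ℂ) : Dist →ₗ[ℂ] Dist where
  toFun F m n := t * (1 - t ^ n) * (F m n - if m = 0 then 0 else F (m - 1) (n - 1))
    + (1 - t ^ (m + 1)) * (F m n - F (m + 1) (n + 1))
  map_add' F G := by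
    ext m n
    simp only [Pi.add_apply]
    split_ifs <;> ring
  map_smul' c F := by
    ext m n
    simp only [Pi.smul_apply, smul_eq_mul, RingHom.id_apply]
    split_ifs <;> ring

theorem lap_apply (t : ℂ) (F : Dist) (m n : ℕ) :
    lap t F m n = t * (1 - t ^ n) * (F m n - if m = 0 then 0 else F (m - 1) (n - 1))
      + (1 - t ^ (m + 1)) * (F m n - F (m + 1) (n + 1)) := rfl

theorem qPoch_succ (t : ℂ) (n : ℕ) : qPoch t (n + 1) = qPoch t n * (1 - t ^ (n + 1)) := by
  simp [qPoch, Finset.prod_range_succ]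

theorem qPoch_zero (t : ℂ) : qPoch t 0 = 1 := by simp [qPoch]

theorem qPoch_ne {t : ℂ} (ht : ∀ n ≠ 0, 1 - t ^ n ≠ 0) (n : ℕ) : qPoch t n ≠ 0 :=
  Finset.prod_ne_zero_iff.mpr fun _ _ => ht _ (by omega)

theorem qBinom_zero (t : ℂ) (r : ℕ) : qBinom t r 0 = 1 := by simp [qBinom, qPoch_zero]

theorem qBinom_mul_add {t : ℂ} (r n : ℕ) :
    qBinom t r n * (1 - t ^ (r + n)) = (1 - t ^ r) * qBinom t (r + 1) n := by
  have h : (∏ j ∈ Finset.range n, (1 - t ^ (r + j))) * (1 - t ^ (r + n))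
      = (1 - t ^ r) * ∏ j ∈ Finset.range n, (1 - t ^ (r + 1 + j)) := by
    rw [← Finset.prod_range_succ, Finset.prod_range_succ', mul_comm]
    simp only [add_zero]
    congr 1
    exact Finset.prod_congr rfl fun j _ => by ring_nf
  rw [qBinom, qBinom, div_mul_eq_mul_div, h, mul_div_assoc]

theorem qBinom_succ {t : ℂ} (ht : ∀ n ≠ 0, 1 - t ^ n ≠ 0) (r n : ℕ) :
    qBinom t r (n + 1) * (1 - t ^ (n + 1)) = (1 - t ^ r) * qBinom t (r + 1) n := by
  rw [← qBinom_mul_add, qBinom, qBinom, qPoch_succ, Finset.prod_range_succ]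
  have := qPoch_ne ht n
  have := ht (n + 1) (by omega)
  field_simp

/-- This is the coefficient form of `1/(x; t)_{r+1} = 1/(1 - x) · 1/(tx; t)_r`: multiplication by
the geometric series takes partial sums of the coefficients `t^j c_j`. -/
theorem sum_qBinom {t : ℂ} (ht : ∀ n ≠ 0, 1 - t ^ n ≠ 0) (r n : ℕ) :
    ∑ j ∈ Finset.range (n + 1), t ^ j * qBinom t r j = qBinom t (r + 1) n := by
  induction n with
  | zero => simp [qBinom_zero]
  | succ n ih =>
    rw [Finset.sum_range_succ, ih]
    have h1 := ht (n + 1) (by omega)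
    have h2 : qBinom t (r + 1) (n + 1)
        = qBinom t (r + 1) n * (1 - t ^ (r + 1 + n)) / (1 - t ^ (n + 1)) := by
      rw [qBinom_mul_add, ← qBinom_succ ht (r + 1), mul_div_cancel_right₀ _ h1]
    rw [h2, eq_div_iff h1, add_mul, mul_assoc, qBinom_succ ht r n]
    ring

theorem monoEntry_val (t : ℂ) (j i r a : ℕ) :
    monoEntry t j i r (a + j) (a + i) = qPoch t (a + i) / qPoch t a * t ^ (r * a) := by
  rw [monoEntry, if_pos ⟨by omega, by omega⟩, Nat.add_sub_cancel]

theorem monoEntry_eq_zero (t : ℂ) (j i r m n : ℕ) (h : ¬ (m + i = n + j ∧ i ≤ n)) :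
    monoEntry t j i r m n = 0 := if_neg h

/-- In the algebra: `z z* = 1 - y` and `t^r z y^r = y^r z`, so that `t^r z y^r z* = y^r (1 - y)`. -/
theorem monoEntry_shift {t : ℂ} (ht : ∀ n ≠ 0, 1 - t ^ n ≠ 0) (j i r m n : ℕ) :
    t ^ r * monoEntry t (j + 1) (i + 1) r m n
      = monoEntry t j i r m n - monoEntry t j i (r + 1) m n := by
  by_cases h : m + i = n + j ∧ i ≤ n
  · obtain ⟨a, rfl⟩ := Nat.exists_eq_add_of_le' h.2
    obtain rfl : m = a + j := by omega
    rw [monoEntry_val, monoEntry_val]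
    rcases a with _ | a
    · rw [monoEntry_eq_zero _ _ _ _ _ _ (by omega)]
      simp
    · rw [show a + 1 + j = a + (j + 1) by ring, show a + 1 + i = a + (i + 1) by ring,
        monoEntry_val, qPoch_succ t a]
      have := qPoch_ne ht a
      have := ht (a + 1) (by omega)
      field_simp
      ring
  · rw [monoEntry_eq_zero _ _ _ _ _ _ h, monoEntry_eq_zero _ _ _ _ _ _ h,
      monoEntry_eq_zero _ _ _ _ _ _ (by omega)]
    simp

/-- The action of `∂̄* ∂̄` on the monomials `z^j y^(s+1) z*^i`. -/
theorem lap_monoEntry {t : ℂ} (ht : ∀ n ≠ 0, 1 - t ^ n ≠ 0) (j i s m n : ℕ) :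
    t ^ s * lap t (monoEntry t j i (s + 1)) m n
      = -((1 - t ^ (s + 1)) * (1 - t ^ s)) * monoEntry t j i (s + 1) m n
        + (1 - t ^ (s + 1 + i)) * (1 - t ^ (s + 1 + j)) * monoEntry t j i (s + 2) m n
        - t ^ s * ((1 - t ^ i) * (1 - t ^ j)) * monoEntry t (j - 1) (i - 1) (s + 2) m n := by
  rw [lap_apply]
  by_cases h : m + i = n + j
  · rcases le_or_gt i n with hi | hi
    · obtain ⟨a, rfl⟩ := Nat.exists_eq_add_of_le' hi
      obtain rfl : m = a + j := by omega
      -- The neighbouring values are compared after clearing denominators. The relation persists at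
      -- `a = 0`: the right side has the factor `1 - t^a = 0`, and on the left either the
      -- predecessor lies outside the support or `1 - t^n` vanishes.
      have hprev : t * (1 - t ^ (a + i)) * (if a + j = 0 then 0 else
            monoEntry t j i (s + 1) (a + j - 1) (a + i - 1)) * (t ^ s * qPoch t a)
          = (1 - t ^ a) * qPoch t (a + i) * t ^ ((s + 1) * a) := by
        rcases a with _ | a
        · split_ifs with h0
          · simp
          · rcases i with _ | i
            · simp
            · rw [monoEntry_eq_zero _ _ _ _ _ _ (by omega)]
              simp
        · rw [if_neg (by omega), show a + 1 + j - 1 = a + j by omega,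
            show a + 1 + i - 1 = a + i by omega, monoEntry_val, show a + 1 + i = a + i + 1 by omega,
            qPoch_succ, qPoch_succ]
          have := qPoch_ne ht a
          field_simp
          ring
      have hlast : (1 - t ^ i) * (1 - t ^ j) * monoEntry t (j - 1) (i - 1) (s + 2) (a + j) (a + i)
          * (qPoch t a * (1 - t ^ (a + 1)))
          = (1 - t ^ i) * (1 - t ^ j) * qPoch t (a + i) * t ^ ((s + 2) * (a + 1)) := by
        rcases i with _ | i
        · simp
        rcases j with _ | j
        · simp
        simp only [Nat.add_sub_cancel]
        rw [show a + (j + 1) = a + 1 + j by ring, show a + (i + 1) = a + 1 + i by ring,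
          monoEntry_val, qPoch_succ t a]
        have := qPoch_ne ht a
        have := ht (a + 1) (by omega)
        field_simp
      have h0 := qPoch_ne ht a
      have h1 := ht (a + 1) (by omega)
      have hnext : monoEntry t j i (s + 1) (a + j + 1) (a + i + 1)
          * (qPoch t a * (1 - t ^ (a + 1)))
          = qPoch t (a + i) * (1 - t ^ (a + i + 1)) * t ^ ((s + 1) * (a + 1)) := by
        rw [show a + j + 1 = a + 1 + j by ring, show a + i + 1 = a + 1 + i by ring, monoEntry_val,
          qPoch_succ t a, show a + 1 + i = a + i + 1 by ring, qPoch_succ]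
        field_simp
      rw [monoEntry_val, monoEntry_val]
      generalize (if a + j = 0 then 0 else
            monoEntry t j i (s + 1) (a + j - 1) (a + i - 1)) = u at *
      generalize monoEntry t j i (s + 1) (a + j + 1) (a + i + 1) = v at *
      generalize monoEntry t (j - 1) (i - 1) (s + 2) (a + j) (a + i) = w at *
      have h2 : qPoch t (a + i) / qPoch t a * qPoch t a = qPoch t (a + i) := div_mul_cancel₀ _ h0
      generalize qPoch t (a + i) / qPoch t a = x at *
      rw [← h2] at hprev hlast hnext
      refine mul_right_cancel₀ (mul_ne_zero h0 h1) ?_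
      linear_combination (-(1 - t ^ (a + 1))) * hprev - t ^ s * (1 - t ^ (a + j + 1)) * hnext
        + t ^ s * hlast
    -- Before the support begins, a contribution survives only if `(m + 1, n + 1)` is the first
    -- non-zero entry of the monomial on its diagonal.
    · have hprev : (if m = 0 then 0 else monoEntry t j i (s + 1) (m - 1) (n - 1)) = 0 := by
        split_ifs
        · rfl
        · exact monoEntry_eq_zero _ _ _ _ _ _ (by omega)
      rw [hprev, monoEntry_eq_zero _ _ _ _ m n (by omega), monoEntry_eq_zero _ _ _ _ m n (by omega)]
      obtain ⟨i, rfl⟩ : ∃ i', i = i' + 1 := ⟨i - 1, by omega⟩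
      obtain ⟨j, rfl⟩ : ∃ j', j = j' + 1 := ⟨j - 1, by omega⟩
      simp only [Nat.add_sub_cancel]
      by_cases hin : i = n
      · subst hin
        obtain rfl : m = j := by omega
        have h1 := monoEntry_val t (m + 1) (i + 1) (s + 1) 0
        have h2 := monoEntry_val t m i (s + 2) 0
        simp only [zero_add, mul_zero, pow_zero, qPoch_zero, div_one, mul_one] at h1 h2
        rw [h1, h2, qPoch_succ]
        ring
      · rw [monoEntry_eq_zero _ _ _ _ _ _ (by omega), monoEntry_eq_zero _ _ _ _ _ _ (by omega)]
        ring
  · rw [monoEntry_eq_zero _ _ _ _ m n (by omega), monoEntry_eq_zero _ _ _ _ m n (by omega),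
      monoEntry_eq_zero _ _ _ _ (m + 1) _ (by omega)]
    -- For `n = 0` the truncated difference `n - 1` could lead back to the support, but the factor
    -- `1 - t^n` vanishes. In the last term `(1 - t^i)(1 - t^j)` neutralises the truncation of `i -
    -- 1` and `j - 1` in the same way.
    have hprev : t * (1 - t ^ n) * (0 - if m = 0 then 0 else
        monoEntry t j i (s + 1) (m - 1) (n - 1)) = 0 := by
      rcases n with _ | n
      · simp
      · split_ifs
        · simp
        · rw [monoEntry_eq_zero _ _ _ _ _ _ (by omega)]
          simp
    rw [hprev]
    rcases i with _ | i
    · simp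
    rcases j with _ | j
    · simp
    rw [monoEntry_eq_zero _ _ _ _ _ _ (by omega)]
    simp

/-! ### The kernels in matrix elements -/

/-- The kernel `∑ t^i c_i c_j (z^j y^r z*^i) ⊗ (ζ^i y^r ζ*^j)` with `c_i = (t^r; t)_i / (t; t)_i`,
in matrix elements. -/
noncomputable def kernelEntry (t : ℂ) (r k l : ℕ) : Dist :=
  ∑ i ∈ Finset.range (k + 1), ∑ j ∈ Finset.range (l + 1),
    (t ^ i * qBinom t r i * qBinom t r j * monoEntry t i j r k l) • monoEntry t j i r

theorem kernelEntry_apply (t : ℂ) (r k l m n : ℕ) :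
    kernelEntry t r k l m n = ∑ i ∈ Finset.range (k + 1), ∑ j ∈ Finset.range (l + 1),
      t ^ i * qBinom t r i * qBinom t r j * monoEntry t i j r k l * monoEntry t j i r m n := by
  simp [kernelEntry, Finset.sum_apply]

theorem sum_range_shift (f : ℕ → ℂ) (k : ℕ) (h0 : f 0 = 0) (hk : f (k + 1) = 0) :
    ∑ i ∈ Finset.range (k + 1), f i = ∑ i ∈ Finset.range (k + 1), f (i + 1) := by
  rw [Finset.sum_range_succ', h0, Finset.sum_range_succ, hk]

/-- Of the three monomials produced by `lap_monoEntry`, the one with lowered indices is re-indexed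
by `i ↦ i + 1`, `j ↦ j + 1`, and `monoEntry_shift` in the second variable splits it into exponents
`s + 1` and `s + 2`. The part with mixed exponents cancels the middle term, and only kernels with
equal exponents in both variables remain. -/
theorem lap_kernelEntry {t : ℂ} (ht : ∀ n ≠ 0, 1 - t ^ n ≠ 0) (s k l m n : ℕ) :
    t ^ s * lap t (kernelEntry t (s + 1) k l) m n
      = (1 - t ^ (s + 1)) * ((1 - t ^ (s + 1)) * kernelEntry t (s + 2) k l m n
        - (1 - t ^ s) * kernelEntry t (s + 1) k l m n) := by
  -- The shift of both indices is free of boundary terms: at index 0 the factors `1 - t^i`, `1 -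
  -- t^j` vanish, and beyond `k`, `l` the monomial in the second variable does. Then `qBinom_succ`
  -- absorbs the factors `1 - t^(i+1)` and `1 - t^(j+1)`.
  have hlast : ∑ i ∈ Finset.range (k + 1), ∑ j ∈ Finset.range (l + 1),
      t ^ i * qBinom t (s + 1) i * qBinom t (s + 1) j * monoEntry t i j (s + 1) k l
        * (t ^ s * ((1 - t ^ i) * (1 - t ^ j)) * monoEntry t (j - 1) (i - 1) (s + 2) m n)
      = ∑ i ∈ Finset.range (k + 1), ∑ j ∈ Finset.range (l + 1),
        (1 - t ^ (s + 1)) ^ 2 * (t ^ i * qBinom t (s + 2) i * qBinom t (s + 2) j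
          * (monoEntry t i j (s + 1) k l - monoEntry t i j (s + 2) k l)
            * monoEntry t j i (s + 2) m n) := by
    rw [sum_range_shift _ k (by simp)
      (Finset.sum_eq_zero fun j _ => by
        rw [monoEntry_eq_zero _ _ _ _ k l (by omega)]; simp)]
    refine Finset.sum_congr rfl fun i _ => ?_
    rw [sum_range_shift _ l (by simp) (by
        rw [monoEntry_eq_zero _ _ _ _ k l (by omega)]; simp)]
    refine Finset.sum_congr rfl fun j _ => ?_
    rw [← monoEntry_shift ht]
    simp only [Nat.add_sub_cancel]
    have h1 := qBinom_succ ht (s + 1) i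
    have h2 := qBinom_succ ht (s + 1) j
    rw [show s + 1 + 1 = s + 2 by ring] at h1 h2
    linear_combination (t ^ s * t ^ (i + 1) * monoEntry t (i + 1) (j + 1) (s + 1) k l
      * monoEntry t j i (s + 2) m n) * (qBinom t (s + 1) (j + 1) * (1 - t ^ (j + 1)) * h1
        + (1 - t ^ (s + 1)) * qBinom t (s + 2) i * h2)
  have hterm : t ^ s * lap t (kernelEntry t (s + 1) k l) m n
      = ∑ i ∈ Finset.range (k + 1), ∑ j ∈ Finset.range (l + 1),
        t ^ i * qBinom t (s + 1) i * qBinom t (s + 1) j * monoEntry t i j (s + 1) k l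
          * (t ^ s * lap t (monoEntry t j i (s + 1)) m n) := by
    simp only [kernelEntry, map_sum, map_smul, Finset.sum_apply, Pi.smul_apply, smul_eq_mul,
      Finset.mul_sum]
    exact Finset.sum_congr rfl fun i _ => Finset.sum_congr rfl fun j _ => by ring
  rw [hterm]
  simp only [lap_monoEntry ht, mul_sub _ _ (_ * monoEntry t (_ - 1) (_ - 1) (s + 2) m n),
    Finset.sum_sub_distrib]
  rw [hlast]
  simp only [kernelEntry_apply, Finset.mul_sum, ← Finset.sum_sub_distrib]
  -- The middle coefficients satisfy `(1 - t^(s+1+i)) c_i = (1 - t^(s+1)) c_i'`, where `c_i'`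
  -- belongs to `s + 2`, and likewise for `j`; this matches the mixed terms of `hlast`.
  refine Finset.sum_congr rfl fun i _ => Finset.sum_congr rfl fun j _ => ?_
  have h1 := qBinom_mul_add (t := t) (s + 1) i
  have h2 := qBinom_mul_add (t := t) (s + 1) j
  rw [show s + 1 + 1 = s + 2 by ring] at h1 h2
  linear_combination (t ^ i * monoEntry t i j (s + 1) k l
      * monoEntry t j i (s + 2) m n) * (qBinom t (s + 1) j * (1 - t ^ (s + 1 + j)) * h1
        + (1 - t ^ (s + 1)) * qBinom t (s + 2) i * h2)

end QDisc

namespace QDisc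

/-! ### Normal ordering of the truncated kernels -/

theorem one_sub_sq_pow_ne (q : ℝ) [Fact (0 < q ∧ q < 1)] (n : ℕ) (hn : n ≠ 0) :
    1 - ((q : ℂ) ^ 2) ^ n ≠ 0 := by
  rw [← pow_mul]
  exact one_sub_ne q _ (by omega)

/-- The truncated geometric series. -/
noncomputable def geom (N : ℕ) : Polynomial ℂ := ∑ i ∈ Finset.range N, Polynomial.X ^ i

/-- The polynomials which truncate the `q`-binomial series. -/
noncomputable def truncBinom (t : ℂ) (N : ℕ) : ℕ → Polynomial ℂ
  | 0 => 1
  | r + 1 => (truncBinom t N r).comp (Polynomial.C t * Polynomial.X) * geom N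

theorem geom_coeff (N i : ℕ) : (geom N).coeff i = if i < N then 1 else 0 := by
  simp [geom, Polynomial.coeff_X_pow]

/-- Coefficients below degree `N` do not see the truncation, so they are those of `1/(x; t)_r`; the
recursion is `sum_qBinom`. -/
theorem truncBinom_coeff {t : ℂ} (ht : ∀ n ≠ 0, 1 - t ^ n ≠ 0) (N r n : ℕ) (hn : n < N) :
    (truncBinom t N r).coeff n = qBinom t r n := by
  induction r generalizing n with
  | zero =>
    rw [truncBinom, Polynomial.coeff_one, qBinom]
    rcases n with _ | n
    · simp [qPoch_zero]
    · rw [Finset.prod_range_succ']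
      simp
  | succ r ih =>
    rw [truncBinom, Polynomial.coeff_mul, Finset.Nat.sum_antidiagonal_eq_sum_range_succ_mk,
      ← sum_qBinom ht]
    refine Finset.sum_congr rfl fun j hj => ?_
    have hj' := Finset.mem_range.mp hj
    rw [Polynomial.comp_C_mul_X_coeff, geom_coeff, if_pos (by omega), ih j (by omega)]
    ring

/-! ### Powers of products with geometric series in `t`-commuting elements. -/

section Ordering

variable {A : Type*} [Semiring A] [Algebra ℂ A]

theorem aeval_comp_C_mul_X (a : A) (t : ℂ) (p : Polynomial ℂ) :
    Polynomial.aeval a (p.comp (Polynomial.C t * Polynomial.X)) = Polynomial.aeval (t • a) p := by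
  rw [Polynomial.aeval_comp]
  simp [Algebra.smul_def]

theorem mul_aeval_of_skew {x b : A} {t : ℂ} (h : b * x = t • (x * b)) (p : Polynomial ℂ) :
    b * Polynomial.aeval x p = Polynomial.aeval (t • x) p * b := by
  induction p using Polynomial.induction_on' with
  | add p p' hp hp' => rw [map_add, map_add, mul_add, add_mul, hp, hp']
  | monomial n c =>
    have key : b * x ^ n = (t • x) ^ n * b := by
      induction n with
      | zero => simp
      | succ n ih =>
        rw [pow_succ, ← mul_assoc, ih, mul_assoc, h, pow_succ, mul_assoc, smul_mul_assoc]
    rw [Polynomial.aeval_monomial, Polynomial.aeval_monomial, ← mul_assoc, ← Algebra.commutes,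
      mul_assoc, key, mul_assoc]

theorem aeval_mul_of_skew {x b : A} {t : ℂ} (h : x * b = t • (b * x)) (p : Polynomial ℂ) :
    Polynomial.aeval x p * b = b * Polynomial.aeval (t • x) p := by
  induction p using Polynomial.induction_on' with
  | add p p' hp hp' => rw [map_add, map_add, mul_add, add_mul, hp, hp']
  | monomial n c =>
    have key : x ^ n * b = b * (t • x) ^ n := by
      induction n with
      | zero => simp
      | succ n ih =>
        rw [pow_succ', mul_assoc, ih, ← mul_assoc, h, pow_succ' (t • x), smul_mul_assoc,
          smul_mul_assoc, mul_smul_comm, mul_assoc]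
    rw [Polynomial.aeval_monomial, Polynomial.aeval_monomial, mul_assoc, key, ← mul_assoc,
      Algebra.commutes, mul_assoc]

theorem geom_aeval (x : A) (N : ℕ) :
    Polynomial.aeval x (geom N) = ∑ i ∈ Finset.range N, x ^ i := by
  simp [geom]

/-- Each factor `b` that is moved to the right past a series in `x` rescales `x` by `t`. The
successive rescalings produce the product of `geom N` at `t x, t² x, …`, which is `truncBinom` at `t
x`. -/
theorem skew_pow_left {x b : A} {t : ℂ} (h : b * x = t • (x * b)) (N r : ℕ) :
    (b * ∑ i ∈ Finset.range N, x ^ i) ^ r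
      = Polynomial.aeval (t • x) (truncBinom t N r) * b ^ r := by
  induction r with
  | zero => simp [truncBinom]
  | succ r ih =>
    have h' : b * (t • x) = t • ((t • x) * b) := by
      rw [mul_smul_comm, h, smul_mul_assoc]
    have hc : Polynomial.aeval (t • x) (geom N)
          * Polynomial.aeval (t • t • x) (truncBinom t N r)
        = Polynomial.aeval (t • t • x) (truncBinom t N r)
          * Polynomial.aeval (t • x) (geom N) := by
      rw [← aeval_comp_C_mul_X (t • x), ← map_mul, ← map_mul, mul_comm]
    rw [pow_succ', ih, ← geom_aeval, mul_aeval_of_skew h, mul_assoc, ← mul_assoc b,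
      mul_aeval_of_skew h', mul_assoc, ← pow_succ', ← mul_assoc, hc, truncBinom, map_mul,
      aeval_comp_C_mul_X]

/-- Here the factors `b` move to the left, so one series keeps its argument unscaled; hence `x` and
not `t • x`, in contrast to `skew_pow_left`. -/
theorem skew_pow_right {x b : A} {t : ℂ} (h : x * b = t • (b * x)) (N r : ℕ) :
    (b * ∑ i ∈ Finset.range N, x ^ i) ^ r
      = b ^ r * Polynomial.aeval x (truncBinom t N r) := by
  induction r with
  | zero => simp [truncBinom]
  | succ r ih =>
    rw [pow_succ, ih, ← geom_aeval, mul_assoc, ← mul_assoc _ b, aeval_mul_of_skew h, mul_assoc b,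
      ← mul_assoc, ← pow_succ, truncBinom, map_mul, aeval_comp_C_mul_X]

end Ordering

theorem op_tmul_mul (q : ℝ) (a a' b b' : Pol q) :
    (MulOpposite.op a ⊗ₜ[ℂ] b : PolPair q) * (MulOpposite.op a' ⊗ₜ b')
      = MulOpposite.op (a' * a) ⊗ₜ (b * b') := by
  rw [Algebra.TensorProduct.tmul_mul_tmul, MulOpposite.op_mul]

theorem op_tmul_pow (q : ℝ) (a b : Pol q) (n : ℕ) :
    (MulOpposite.op a ⊗ₜ[ℂ] b : PolPair q) ^ n = MulOpposite.op (a ^ n) ⊗ₜ (b ^ n) := by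
  rw [Algebra.TensorProduct.tmul_pow, MulOpposite.op_pow]

/-- The powers of `1 - ζζ*` are collected to the right of the series in `z*ζ`, those of `1 - z*z` to
the left of the series in `zζ*`. Since the first tensor factor carries the opposite product, `1 -
z*z` is `y` there, and both factors end up in the order `z`, `y`, `z*`. The power `t^i` stems from
the asymmetry between `skew_pow_left` and `skew_pow_right`. -/
theorem truncG_eq (q : ℝ) (r N M : ℕ)
    (hM : (truncBinom ((q : ℂ) ^ 2) N r).natDegree < M) :
    truncG q r N = ∑ i ∈ Finset.range M, ∑ j ∈ Finset.range M,
      (((q : ℂ) ^ 2) ^ i * (truncBinom ((q : ℂ) ^ 2) N r).coeff i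
        * (truncBinom ((q : ℂ) ^ 2) N r).coeff j) •
      (MulOpposite.op (z q ^ j * y q ^ r * zs q ^ i) ⊗ₜ[ℂ] (z q ^ i * y q ^ r * zs q ^ j)) := by
  have hx : zsL q * ζ q = MulOpposite.op (zs q) ⊗ₜ z q := by
    rw [zsL, ζ, ← MulOpposite.op_one, op_tmul_mul, one_mul, one_mul]
  have hw : zL q * ζs q = MulOpposite.op (z q) ⊗ₜ zs q := by
    rw [zL, ζs, ← MulOpposite.op_one, op_tmul_mul, one_mul, one_mul]
  have hb : 1 - ζ q * ζs q = MulOpposite.op 1 ⊗ₜ y q := by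
    rw [ζ, ζs, ← MulOpposite.op_one, op_tmul_mul, y, TensorProduct.tmul_sub, one_mul]
    rfl
  have hc : 1 - zsL q * zL q = MulOpposite.op (y q) ⊗ₜ 1 := by
    rw [zsL, zL, op_tmul_mul, y, MulOpposite.op_sub, TensorProduct.sub_tmul, one_mul]
    rfl
  rw [truncG, hx, hw, hb, hc, skew_pow_left (t := (q : ℂ) ^ 2), skew_pow_right (t := (q : ℂ) ^ 2),
    Polynomial.aeval_eq_sum_range' hM, Polynomial.aeval_eq_sum_range' hM, op_tmul_pow, op_tmul_pow,
    mul_assoc, ← mul_assoc _ _ (∑ _ ∈ _, _), op_tmul_mul, Finset.mul_sum, Finset.sum_mul]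
  · refine Finset.sum_congr rfl fun i _ => ?_
    rw [Finset.mul_sum]
    refine Finset.sum_congr rfl fun j _ => ?_
    rw [smul_pow, op_tmul_pow, op_tmul_pow, smul_smul, mul_smul_comm, mul_smul_comm,
      smul_mul_assoc, op_tmul_mul, op_tmul_mul, smul_smul]
    simp only [one_pow, mul_one, mul_assoc]
    congr 1
    ring
  · rw [op_tmul_mul, op_tmul_mul, one_mul, mul_one, y_mul_z, MulOpposite.op_smul,
      TensorProduct.smul_tmul']
  · rw [op_tmul_mul, op_tmul_mul, one_mul, mul_one, y_mul_z, TensorProduct.tmul_smul]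

/-! ### Matrix elements of ordered monomials and of the kernels `G_m`. -/

theorem qPoch_ofReal (q : ℝ) (n : ℕ) : qPoch ((q : ℂ) ^ 2) n = (poch q n : ℂ) := by
  simp [qPoch, poch, pow_mul]

theorem lower_pow_single' (q : ℝ) [Fact (0 < q ∧ q < 1)] (i a : ℕ) :
    (lower q ^ i) (Finsupp.single (a + i) 1)
      = (qPoch ((q : ℂ) ^ 2) (a + i) / qPoch ((q : ℂ) ^ 2) a) • (Finsupp.single a 1 : Fock) := by
  rw [add_comm a i, lower_pow_single]
  congr 1
  rw [eq_div_iff (qPoch_ne (one_sub_sq_pow_ne q) a), qPoch, qPoch, add_comm i a,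
    Finset.prod_range_add, mul_comm]
  congr 1
  exact Finset.prod_congr rfl fun s _ => by rw [← pow_mul]

theorem T_y_pow_single (q : ℝ) (r n : ℕ) :
    (T q (y q) ^ r) (Finsupp.single n 1)
      = ((q : ℂ) ^ 2) ^ (r * n) • (Finsupp.single n 1 : Fock) := by
  induction r with
  | zero => simp
  | succ r ih =>
    rw [pow_succ', Module.End.mul_apply, ih, map_smul, T_y_single, smul_smul, ← pow_mul, ← pow_mul,
      ← pow_add]
    congr 2
    ring

theorem toDist_monomial (q : ℝ) [Fact (0 < q ∧ q < 1)] (j r i m n : ℕ) :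
    toDist q (z q ^ j * y q ^ r * zs q ^ i) m n = monoEntry ((q : ℂ) ^ 2) j i r m n := by
  change T q (z q ^ j * y q ^ r * zs q ^ i) (Finsupp.single n 1) m = _
  simp only [map_mul, map_pow, T_z, T_zs, Module.End.mul_apply]
  rcases lt_or_ge n i with h | h
  · rw [lower_pow_single_of_lt q i n h, map_zero, map_zero, monoEntry_eq_zero _ _ _ _ _ _ (by omega)]
    rfl
  · obtain ⟨a, rfl⟩ := Nat.exists_eq_add_of_le' h
    rw [lower_pow_single', map_smul, T_y_pow_single, map_smul, map_smul, raise_pow_single, smul_smul,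
      Finsupp.smul_apply, Finsupp.single_apply, smul_eq_mul]
    split_ifs with hm
    · subst hm
      rw [monoEntry_val, mul_one]
    · rw [monoEntry_eq_zero _ _ _ _ _ _ (by omega), mul_zero]

/-- A monomial with `i > k` or `j > l` has zero entry at `(k, l)` in the second variable, so a fixed
entry involves only coefficients of degree below `N` and is independent of `N` from some point on.
-/
theorem toDist₂_truncG (q : ℝ) [Fact (0 < q ∧ q < 1)] (r N m n k l : ℕ) (hk : k < N) (hl : l < N) :
    toDist₂ q (truncG q r N) m n k l = kernelEntry ((q : ℂ) ^ 2) r k l m n := by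
  -- Large enough to exceed the degree and to contain all indices `i ≤ k` and `j ≤ l`.
  set M := (truncBinom ((q : ℂ) ^ 2) N r).natDegree + 1 + k + l with hM
  rw [truncG_eq q r N M (by omega), kernelEntry_apply]
  simp only [map_sum, map_smul, Finset.sum_apply, Pi.smul_apply, toDist₂_tmul, toDist_monomial,
    smul_eq_mul]
  rw [← Finset.sum_subset (Finset.range_mono (show k + 1 ≤ M by omega))]
  · refine Finset.sum_congr rfl fun i hi => ?_
    rw [← Finset.sum_subset (Finset.range_mono (show l + 1 ≤ M by omega))]
    · refine Finset.sum_congr rfl fun j hj => ?_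
      have hi := Finset.mem_range.mp hi
      have hj := Finset.mem_range.mp hj
      rw [truncBinom_coeff (one_sub_sq_pow_ne q) N r i (by omega),
        truncBinom_coeff (one_sub_sq_pow_ne q) N r j (by omega)]
      ring
    · intro j _ hj
      rw [Finset.mem_range] at hj
      rw [monoEntry_eq_zero _ _ _ _ k l (by omega), mul_zero, mul_zero]
  · intro i _ hi
    rw [Finset.mem_range] at hi
    refine Finset.sum_eq_zero fun j _ => ?_
    rw [monoEntry_eq_zero _ _ _ _ k l (by omega), mul_zero, mul_zero]

theorem tendsto_truncG (q : ℝ) [Fact (0 < q ∧ q < 1)] (r : ℕ) :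
    Tendsto (fun N => toDist₂ q (truncG q r N)) atTop
      (𝓝 fun m n k l => kernelEntry ((q : ℂ) ^ 2) r k l m n) := by
  refine tendsto_pi_nhds.mpr fun m => tendsto_pi_nhds.mpr fun n => tendsto_pi_nhds.mpr fun k =>
    tendsto_pi_nhds.mpr fun l => tendsto_const_nhds.congr' ?_
  filter_upwards [eventually_gt_atTop (k + l)] with N hN
  exact (toDist₂_truncG q r N m n k l (by omega) (by omega)).symm

theorem G_apply (q : ℝ) [Fact (0 < q ∧ q < 1)] (r m n k l : ℕ) :
    G q r m n k l = kernelEntry ((q : ℂ) ^ 2) r k l m n := by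
  rw [G, (tendsto_truncG q r).limUnder_eq]

end QDisc

namespace QDisc

/-! ### Convergence of the series for the Green function -/

theorem sq_pow_pos (q : ℝ) [hq : Fact (0 < q ∧ q < 1)] (n : ℕ) : 0 < (q ^ 2) ^ n :=
  pow_pos (pow_pos hq.out.1 2) n

theorem sq_pow_le_one (q : ℝ) [hq : Fact (0 < q ∧ q < 1)] (n : ℕ) : (q ^ 2) ^ n ≤ 1 :=
  pow_le_one₀ (sq_nonneg q) (pow_le_one₀ hq.out.1.le hq.out.2.le)

theorem sq_lt_one (q : ℝ) [hq : Fact (0 < q ∧ q < 1)] : q ^ 2 < 1 :=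
  pow_lt_one₀ hq.out.1.le hq.out.2 (by norm_num)

theorem norm_sq_ofReal (q : ℝ) : ‖(q : ℂ) ^ 2‖ = q ^ 2 := by
  rw [norm_pow, Complex.norm_real, Real.norm_eq_abs, sq_abs]

theorem norm_one_sub_sq_pow (q : ℝ) [Fact (0 < q ∧ q < 1)] (n : ℕ) :
    ‖1 - ((q : ℂ) ^ 2) ^ n‖ = 1 - (q ^ 2) ^ n := by
  have : (1 - ((q : ℂ) ^ 2) ^ n) = ((1 - (q ^ 2) ^ n : ℝ) : ℂ) := by push_cast; rfl
  rw [this, Complex.norm_real, Real.norm_eq_abs, abs_of_nonneg]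
  linarith [sq_pow_le_one q n]

theorem norm_one_sub_sq_pow_le (q : ℝ) [Fact (0 < q ∧ q < 1)] (n : ℕ) :
    ‖1 - ((q : ℂ) ^ 2) ^ n‖ ≤ 1 := by
  rw [norm_one_sub_sq_pow]
  linarith [sq_pow_pos q n]

theorem norm_qPoch (q : ℝ) [Fact (0 < q ∧ q < 1)] (n : ℕ) :
    ‖qPoch ((q : ℂ) ^ 2) n‖ = poch q n := by
  rw [qPoch_ofReal, Complex.norm_real, Real.norm_eq_abs, abs_of_pos (poch_pos q n)]

theorem poch_antitone (q : ℝ) [Fact (0 < q ∧ q < 1)] : Antitone (poch q) := by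
  refine antitone_nat_of_succ_le fun n => ?_
  rw [poch_succ, pow_mul]
  nlinarith [sq_pow_pos q (n + 1), poch_pos q n]

theorem norm_qBinom_le (q : ℝ) [Fact (0 < q ∧ q < 1)] {i k : ℕ} (r : ℕ) (hik : i ≤ k) :
    ‖qBinom ((q : ℂ) ^ 2) r i‖ ≤ (poch q k)⁻¹ := by
  rw [qBinom, norm_div, norm_qPoch, div_eq_mul_inv, ← one_mul (poch q k)⁻¹]
  refine mul_le_mul ?_ ?_ (inv_nonneg.mpr (poch_pos q i).le) zero_le_one
  · rw [norm_prod]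
    exact Finset.prod_le_one (fun _ _ => norm_nonneg _) fun _ _ => norm_one_sub_sq_pow_le q _
  · exact inv_anti₀ (poch_pos q k) (poch_antitone q hik)

/-- A single factor of `y` already gives the decay, so the bound does not depend on `s`. -/
theorem norm_monoEntry_le (q : ℝ) [Fact (0 < q ∧ q < 1)] (j i s m n : ℕ) :
    ‖monoEntry ((q : ℂ) ^ 2) j i (s + 1) m n‖ ≤ (q ^ 2) ^ (n - i) := by
  rw [monoEntry]
  split_ifs with h
  · rw [norm_mul, norm_div, norm_qPoch, norm_qPoch, norm_pow, norm_sq_ofReal]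
    have h1 : poch q n / poch q (n - i) ≤ 1 :=
      div_le_one_of_le₀ (poch_antitone q (Nat.sub_le n i)) (poch_pos q _).le
    have h2 : (q ^ 2) ^ ((s + 1) * (n - i)) ≤ (q ^ 2) ^ (n - i) :=
      pow_le_pow_of_le_one (sq_nonneg q) (sq_lt_one q).le
        (Nat.le_mul_of_pos_left _ (Nat.succ_pos s))
    calc _ ≤ 1 * (q ^ 2) ^ (n - i) := mul_le_mul h1 h2 (by positivity) zero_le_one
      _ = _ := one_mul _
  · rw [norm_zero]
    positivity

/-- The bound is uniform in `s`, which is needed for convergence of the series, and decays in `n`,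
which is needed for uniqueness. -/
theorem norm_kernelEntry_le (q : ℝ) [Fact (0 < q ∧ q < 1)] (s k l m n : ℕ) :
    ‖kernelEntry ((q : ℂ) ^ 2) (s + 1) k l m n‖
      ≤ (k + 1) * (l + 1) * ((poch q k)⁻¹ * (poch q l)⁻¹) * (q ^ 2) ^ (n - k) := by
  rw [kernelEntry_apply]
  have hterm : ∀ i ∈ Finset.range (k + 1), ∀ j ∈ Finset.range (l + 1),
      ‖((q : ℂ) ^ 2) ^ i * qBinom ((q : ℂ) ^ 2) (s + 1) i * qBinom ((q : ℂ) ^ 2) (s + 1) j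
        * monoEntry ((q : ℂ) ^ 2) i j (s + 1) k l * monoEntry ((q : ℂ) ^ 2) j i (s + 1) m n‖
      ≤ (poch q k)⁻¹ * (poch q l)⁻¹ * (q ^ 2) ^ (n - k) := by
    intro i hi j hj
    have hi := Finset.mem_range.mp hi
    have hj := Finset.mem_range.mp hj
    have hk := inv_nonneg.mpr (poch_pos q k).le
    have hl := inv_nonneg.mpr (poch_pos q l).le
    simp only [norm_mul]
    have h1 : ‖((q : ℂ) ^ 2) ^ i‖ ≤ 1 := by
      rw [norm_pow, norm_sq_ofReal]; exact sq_pow_le_one q i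
    have h2 := norm_qBinom_le q (s + 1) (show i ≤ k by omega)
    have h3 := norm_qBinom_le q (s + 1) (show j ≤ l by omega)
    have h4 := (norm_monoEntry_le q i j s k l).trans (sq_pow_le_one q _)
    have h5 := (norm_monoEntry_le q j i s m n).trans
      (pow_le_pow_of_le_one (sq_nonneg q) (sq_lt_one q).le (show n - k ≤ n - i by omega))
    calc _ ≤ 1 * (poch q k)⁻¹ * (poch q l)⁻¹ * 1 * (q ^ 2) ^ (n - k) := by gcongr
      _ = _ := by ring
  refine (norm_sum_le_of_le _ fun i hi => norm_sum_le_of_le _ (hterm i hi)).trans (le_of_eq ?_)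
  simp
  ring

/-- With `t = q²` the coefficient equals `t^s (1 - t)/(1 - t^(s+1))`, and the quotient is at most 1.
-/
theorem norm_greenCoeff_le (q : ℝ) [hq : Fact (0 < q ∧ q < 1)] (s : ℕ) :
    ‖((q ^ 2)⁻¹ - 1) / ((q ^ (2 * (s + 1)))⁻¹ - 1)‖ ≤ (q ^ 2) ^ s := by
  have h0 := sq_pow_pos q s
  have h1 := sq_lt_one q
  have h2 : (0 : ℝ) < q ^ 2 := pow_pos hq.out.1 2
  have h3 : q ^ 2 * (q ^ 2) ^ s < 1 := by nlinarith [sq_pow_le_one q s]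
  have h4 : ((q ^ 2)⁻¹ - 1) / ((q ^ (2 * (s + 1)))⁻¹ - 1)
      = (q ^ 2) ^ s * ((1 - q ^ 2) / (1 - q ^ 2 * (q ^ 2) ^ s)) := by
    rw [pow_mul, pow_succ' (q ^ 2) s]
    have h5 : 1 - q ^ 2 * (q ^ 2) ^ s ≠ 0 := by linarith
    generalize (q ^ 2) ^ s = b at *
    generalize q ^ 2 = a at *
    have h6 : (a * b)⁻¹ - 1 = (1 - a * b) / (a * b) := by field_simp
    have h7 : a⁻¹ - 1 = (1 - a) / a := by field_simp
    rw [h6, h7]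
    field_simp
  have h7 : (1 - q ^ 2) / (1 - q ^ 2 * (q ^ 2) ^ s) ≤ 1 :=
    div_le_one_of_le₀ (by nlinarith [sq_pow_le_one q s]) (by linarith)
  rw [h4, Real.norm_eq_abs, abs_of_nonneg (mul_nonneg h0.le (div_nonneg (by linarith) (by linarith)))]
  exact mul_le_of_le_one_right h0.le h7

theorem greenTerm_apply (q : ℝ) [Fact (0 < q ∧ q < 1)] (r m n k l : ℕ) :
    greenTerm q r m n k l = ((((q ^ 2)⁻¹ - 1) / ((q ^ (2 * r))⁻¹ - 1) : ℝ) : ℂ)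
      * kernelEntry ((q : ℂ) ^ 2) r k l m n := by
  rw [← G_apply]
  simp [greenTerm]

/-- The bound for the terms of the series which is uniform along diagonals. -/
theorem norm_greenTerm_le (q : ℝ) [Fact (0 < q ∧ q < 1)] (s m n k l : ℕ) :
    ‖greenTerm q (s + 1) m n k l‖ ≤ (q ^ 2) ^ s *
      ((k + 1) * (l + 1) * ((poch q k)⁻¹ * (poch q l)⁻¹) * (q ^ 2) ^ (n - k)) := by
  rw [greenTerm_apply, norm_mul, Complex.norm_real]
  exact mul_le_mul (norm_greenCoeff_le q s) (norm_kernelEntry_le q s k l m n) (norm_nonneg _)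
    (sq_pow_pos q s).le

theorem summable_sq_pow (q : ℝ) [Fact (0 < q ∧ q < 1)] : Summable fun s : ℕ => (q ^ 2) ^ s :=
  summable_geometric_of_lt_one (sq_nonneg q) (sq_lt_one q)

theorem summable_greenTerm_entry (q : ℝ) [Fact (0 < q ∧ q < 1)] (m n k l : ℕ) :
    Summable fun s => greenTerm q (s + 1) m n k l :=
  Summable.of_norm_bounded ((summable_sq_pow q).mul_right _)
    fun s => norm_greenTerm_le q s m n k l

theorem summable_greenTerm (q : ℝ) [Fact (0 < q ∧ q < 1)] :
    Summable fun s => greenTerm q (s + 1) :=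
  Pi.summable.mpr fun m => Pi.summable.mpr fun n => Pi.summable.mpr fun k => Pi.summable.mpr fun l =>
    summable_greenTerm_entry q m n k l

theorem hasSum_green (q : ℝ) [Fact (0 < q ∧ q < 1)] :
    HasSum (fun s => -greenTerm q (s + 1)) (green q) :=
  (summable_greenTerm q).hasSum.neg

theorem hasSum_green_entry (q : ℝ) [Fact (0 < q ∧ q < 1)] (m n k l : ℕ) :
    HasSum (fun s => -greenTerm q (s + 1) m n k l) (green q m n k l) :=
  Pi.hasSum.mp (Pi.hasSum.mp (Pi.hasSum.mp (Pi.hasSum.mp (hasSum_green q) m) n) k) l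

/-- The factor `t^(n + s - k)` comes out of the sum over `r`, leaving a convergent geometric series.
-/
theorem tendsto_green_diag (q : ℝ) [Fact (0 < q ∧ q < 1)] (m n k l : ℕ) :
    Tendsto (fun s => green q (m + s) (n + s) k l) atTop (𝓝 0) := by
  set C : ℝ := (k + 1) * (l + 1) * ((poch q k)⁻¹ * (poch q l)⁻¹) with hC
  refine squeeze_zero_norm (a := fun s => ∑' r : ℕ, (q ^ 2) ^ r * (C * (q ^ 2) ^ (n + s - k)))
    (fun s => ?_) ?_
  · rw [← (hasSum_green_entry q (m + s) (n + s) k l).tsum_eq]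
    refine tsum_of_norm_bounded ((summable_sq_pow q).mul_right _).hasSum fun r => ?_
    rw [norm_neg]
    exact norm_greenTerm_le q r _ _ k l
  · simp only [tsum_mul_right]
    have h1 : Tendsto (fun s => (q ^ 2) ^ (n + s - k)) atTop (𝓝 0) := by
      refine (tendsto_pow_atTop_nhds_zero_of_lt_one (sq_nonneg q) (sq_lt_one q)).comp ?_
      refine tendsto_atTop_mono (fun s => ?_) (tendsto_sub_atTop_nat k)
      omega
    simpa using (h1.const_mul C).const_mul (∑' r : ℕ, (q ^ 2) ^ r)

/-! ### The Green function is a fundamental solution -/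

theorem tendsto_sq_pow_zero (q : ℝ) [Fact (0 < q ∧ q < 1)] :
    Tendsto (fun s : ℕ => ((q : ℂ) ^ 2) ^ s) atTop (𝓝 0) := by
  refine tendsto_pow_atTop_nhds_zero_of_norm_lt_one ?_
  rw [norm_sq_ofReal]
  exact sq_lt_one q

theorem tendsto_qBinom (q : ℝ) [Fact (0 < q ∧ q < 1)] (i : ℕ) :
    Tendsto (fun r => qBinom ((q : ℂ) ^ 2) r i) atTop (𝓝 (qPoch ((q : ℂ) ^ 2) i)⁻¹) := by
  have h : Tendsto (fun r => ∏ j ∈ Finset.range i, (1 - ((q : ℂ) ^ 2) ^ (r + j))) atTop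
      (𝓝 (∏ j ∈ Finset.range i, (1 - 0))) := by
    refine tendsto_finsetProd _ fun j _ => tendsto_const_nhds.sub ?_
    exact (tendsto_sq_pow_zero q).comp (tendsto_add_atTop_nat j)
  simpa [qBinom] using h.div_const (qPoch ((q : ℂ) ^ 2) i)

/-- As `r → ∞`, `y^r` tends to the projection onto `v_0`, so only the entry whose column is lowered
exactly to `v_0` survives. -/
theorem tendsto_monoEntry (q : ℝ) [Fact (0 < q ∧ q < 1)] (j i m n : ℕ) :
    Tendsto (fun r => monoEntry ((q : ℂ) ^ 2) j i r m n) atTop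
      (𝓝 (if m = j ∧ n = i then qPoch ((q : ℂ) ^ 2) n else 0)) := by
  by_cases h : m + i = n + j ∧ i ≤ n
  · obtain ⟨a, rfl⟩ := Nat.exists_eq_add_of_le' h.2
    obtain rfl : m = a + j := by omega
    simp only [monoEntry_val]
    rcases a with _ | a
    · simp [qPoch_zero]
    · rw [if_neg (by omega), ← mul_zero (qPoch ((q : ℂ) ^ 2) (a + 1 + i) / _)]
      refine Tendsto.const_mul _ ((tendsto_sq_pow_zero q).comp ?_)
      exact tendsto_atTop_mono (fun r => Nat.le_mul_of_pos_right r (Nat.succ_pos a)) tendsto_id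
  · rw [if_neg (by omega)]
    simp only [monoEntry_eq_zero _ _ _ _ _ _ h]
    exact tendsto_const_nhds

/-- In the limit only `i = k`, `j = l` contribute, and the Pochhammer symbols cancel. The remaining
`t^k` compensates the weight `t^{-k}` of `ν`, so that the limit represents `1 - t` times the
identity operator. -/
theorem tendsto_kernelEntry (q : ℝ) [Fact (0 < q ∧ q < 1)] (k l m n : ℕ) :
    Tendsto (fun r => kernelEntry ((q : ℂ) ^ 2) r k l m n) atTop
      (𝓝 (if m = l ∧ n = k then ((q : ℂ) ^ 2) ^ k else 0)) := by
  have h : Tendsto (fun r => kernelEntry ((q : ℂ) ^ 2) r k l m n) atTop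
      (𝓝 (∑ i ∈ Finset.range (k + 1), ∑ j ∈ Finset.range (l + 1),
        ((q : ℂ) ^ 2) ^ i * (qPoch ((q : ℂ) ^ 2) i)⁻¹ * (qPoch ((q : ℂ) ^ 2) j)⁻¹
        * (if k = i ∧ l = j then qPoch ((q : ℂ) ^ 2) l else 0)
        * (if m = j ∧ n = i then qPoch ((q : ℂ) ^ 2) n else 0))) := by
    simp only [kernelEntry_apply]
    refine tendsto_finsetSum _ fun i _ => tendsto_finsetSum _ fun j _ => ?_
    exact (((tendsto_const_nhds.mul (tendsto_qBinom q i)).mul (tendsto_qBinom q j)).mul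
      (tendsto_monoEntry q i j k l)).mul (tendsto_monoEntry q j i m n)
  convert h using 2
  rw [Finset.sum_eq_single k, Finset.sum_eq_single l]
  · have h1 := qPoch_ne (one_sub_sq_pow_ne q) k
    have h2 := qPoch_ne (one_sub_sq_pow_ne q) l
    split_ifs with h3 h4 <;> simp_all
  · intro j _ hj
    rw [if_neg (by omega)]
    simp
  · simp
  · intro i _ hi
    refine Finset.sum_eq_zero fun j _ => ?_
    rw [if_neg (by omega)]
    simp
  · simp

/-- The coefficient of the series times `1 - t^(s+1)` is `(1 - t) t^s`. This removes the factor
`t^s` in `lap_kernelEntry` and leaves a difference of consecutive terms of one sequence. -/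
theorem lap_greenTerm (q : ℝ) [hq : Fact (0 < q ∧ q < 1)] (s k l m n : ℕ) :
    lap ((q : ℂ) ^ 2) (fun m n => greenTerm q (s + 1) m n k l) m n
      = (1 - (q : ℂ) ^ 2) * ((1 - ((q : ℂ) ^ 2) ^ (s + 1))
            * kernelEntry ((q : ℂ) ^ 2) (s + 2) k l m n
          - (1 - ((q : ℂ) ^ 2) ^ s) * kernelEntry ((q : ℂ) ^ 2) (s + 1) k l m n) := by
  have h1 : (fun m n => greenTerm q (s + 1) m n k l)
      = ((((q ^ 2)⁻¹ - 1) / ((q ^ (2 * (s + 1)))⁻¹ - 1) : ℝ) : ℂ)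
        • kernelEntry ((q : ℂ) ^ 2) (s + 1) k l := by
    ext m n
    rw [greenTerm_apply]
    rfl
  have h2 := lap_kernelEntry (one_sub_sq_pow_ne q) s k l m n
  have h3 := one_sub_sq_pow_ne q (s + 1) (by omega)
  have h4 : ((q : ℂ) ^ 2) ≠ 0 := pow_ne_zero _ (q_ne q)
  have h5 : ((((q ^ 2)⁻¹ - 1) / ((q ^ (2 * (s + 1)))⁻¹ - 1) : ℝ) : ℂ)
      * (1 - ((q : ℂ) ^ 2) ^ (s + 1)) = (1 - (q : ℂ) ^ 2) * ((q : ℂ) ^ 2) ^ s := by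
    rw [pow_mul]
    push_cast
    generalize (q : ℂ) ^ 2 = t at *
    have h6 : (t ^ (s + 1))⁻¹ - 1 = (1 - t ^ (s + 1)) / t ^ (s + 1) := by
      field_simp
    rw [h6]
    field_simp
    ring
  rw [h1, map_smul]
  change _ * lap _ _ m n = _
  refine mul_left_cancel₀ (mul_ne_zero h3 (pow_ne_zero s h4)) ?_
  generalize ((((q ^ 2)⁻¹ - 1) / ((q ^ (2 * (s + 1)))⁻¹ - 1) : ℝ) : ℂ) = a at *
  linear_combination a * (1 - ((q : ℂ) ^ 2) ^ (s + 1)) * h2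
    + (1 - ((q : ℂ) ^ 2) ^ (s + 1)) * ((1 - ((q : ℂ) ^ 2) ^ (s + 1))
            * kernelEntry ((q : ℂ) ^ 2) (s + 2) k l m n
          - (1 - ((q : ℂ) ^ 2) ^ s) * kernelEntry ((q : ℂ) ^ 2) (s + 1) k l m n) * h5

theorem continuous_lap (t : ℂ) : Continuous (lap t) := by
  refine continuous_pi fun m => continuous_pi fun n => ?_
  simp only [lap_apply]
  split_ifs <;> fun_prop

/-- The Green function is a fundamental solution. -/
theorem lap_green (q : ℝ) [Fact (0 < q ∧ q < 1)] (k l m n : ℕ) :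
    lap ((q : ℂ) ^ 2) (fun m n => green q m n k l) m n
      = if m = l ∧ n = k then -((1 - (q : ℂ) ^ 2) * ((q : ℂ) ^ 2) ^ k) else 0 := by
  have h1 : HasSum (fun s => -(fun m n => greenTerm q (s + 1) m n k l : Dist))
      (fun m n => green q m n k l) :=
    Pi.hasSum.mpr fun m => Pi.hasSum.mpr fun n => hasSum_green_entry q m n k l
  have h2 := Pi.hasSum.mp (Pi.hasSum.mp (h1.map (lap ((q : ℂ) ^ 2)) (continuous_lap _)) m) n
  have h3 := h2.tendsto_sum_nat
  refine tendsto_nhds_unique h3 ?_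
  -- The sum telescopes; its lower end vanishes because of the factor `1 - t^0`.
  have h4 : ∀ N, ∑ s ∈ Finset.range N,
      ((lap ((q : ℂ) ^ 2)) ∘ fun s => -(fun m n => greenTerm q (s + 1) m n k l : Dist)) s m n
      = -((1 - (q : ℂ) ^ 2) * ((1 - ((q : ℂ) ^ 2) ^ N)
            * kernelEntry ((q : ℂ) ^ 2) (N + 1) k l m n)) := by
    intro N
    induction N with
    | zero => simp
    | succ N ih =>
      rw [Finset.sum_range_succ, ih, Function.comp_apply, map_neg, Pi.neg_apply, Pi.neg_apply,
        lap_greenTerm]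
      ring
  simp only [h4]
  have h5 : Tendsto (fun N => -((1 - (q : ℂ) ^ 2) * ((1 - ((q : ℂ) ^ 2) ^ N)
            * kernelEntry ((q : ℂ) ^ 2) (N + 1) k l m n))) atTop
      (𝓝 (-((1 - (q : ℂ) ^ 2) * ((1 - 0) * if m = l ∧ n = k then ((q : ℂ) ^ 2) ^ k else 0)))) :=
    (((tendsto_const_nhds.sub (tendsto_sq_pow_zero q)).mul
      ((tendsto_kernelEntry q k l m n).comp (tendsto_add_atTop_nat 1))).const_mul _).neg
  convert h5 using 2
  split_ifs <;> simp

/-- For finite functions, the integral operator is given by finite sums. -/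
theorem intOp_apply (q : ℝ) (K : Dist₂) (F : Dist) (N : ℕ)
    (hN : ∀ m n, F m n ≠ 0 → m < N ∧ n < N) (m n : ℕ) :
    intOp q K F m n = ∑ k ∈ Finset.range N, ∑ l ∈ Finset.range N,
      ((1 - (q : ℂ) ^ 2) * (((q : ℂ) ^ 2) ^ k / (((q : ℂ) ^ 2) ^ k) ^ 2) * F l k) * K m n k l := by
  have h0 : ∀ m n, ¬ (m < N ∧ n < N) → F m n = 0 := fun m n h => by
    by_contra h'
    exact h (hN m n h')
  rw [intOp, nu, mu, tsum_eq_sum (s := Finset.range N), Finset.mul_sum]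
  · refine Finset.sum_congr rfl fun k _ => ?_
    rw [mulYInvSq, distMul, tsum_eq_sum (s := Finset.range N)]
    · rw [Finset.sum_mul, Finset.sum_mul, Finset.mul_sum]
      refine Finset.sum_congr rfl fun l _ => ?_
      rw [pow_mul]
      ring
    · intro l hl
      rw [h0 l k (fun h => hl (Finset.mem_range.mpr h.1)), mul_zero]
  · intro k hk
    have : ∀ l, F l k = 0 := fun l => h0 l k fun h => hk (Finset.mem_range.mpr h.2)
    simp [mulYInvSq, distMul, this]

/-- One factor `1 - t` comes from `lap_green`, the other from the normalisation of `ν`; the powers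
`t^k` and `t^{-k}` cancel. -/
theorem lap_intOp_green (q : ℝ) [Fact (0 < q ∧ q < 1)] {F : Dist} (hF : F ∈ finFun) :
    lap ((q : ℂ) ^ 2) (intOp q (green q) F) = (-(1 - (q : ℂ) ^ 2) ^ 2) • F := by
  obtain ⟨N, hN⟩ := exists_bound hF
  have h1 : intOp q (green q) F = ∑ k ∈ Finset.range N, ∑ l ∈ Finset.range N,
      ((1 - (q : ℂ) ^ 2) * (((q : ℂ) ^ 2) ^ k / (((q : ℂ) ^ 2) ^ k) ^ 2) * F l k)
        • (fun m n => green q m n k l : Dist) := by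
    ext m n
    rw [intOp_apply q _ F N hN]
    simp [Finset.sum_apply]
  rw [h1]
  ext m n
  simp only [map_sum, map_smul, Finset.sum_apply, Pi.smul_apply, smul_eq_mul, lap_green]
  by_cases hmn : F m n = 0
  · rw [hmn, mul_zero]
    refine Finset.sum_eq_zero fun k _ => Finset.sum_eq_zero fun l _ => ?_
    split_ifs with h
    · rw [← h.1, ← h.2, hmn]
      simp
    · simp
  · obtain ⟨hm, hn⟩ := hN m n hmn
    rw [Finset.sum_eq_single n, Finset.sum_eq_single m]
    · have := pow_ne_zero n (pow_ne_zero 2 (q_ne q))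
      simp only [and_self, if_true]
      field_simp
    · intro l _ hl
      rw [if_neg (by tauto), mul_zero]
    · simp [hm]
    · intro k _ hk
      refine Finset.sum_eq_zero fun l _ => ?_
      rw [if_neg (by tauto), mul_zero]
    · simp [hn]

theorem tendsto_intOp_green_diag (q : ℝ) [Fact (0 < q ∧ q < 1)] {F : Dist} (hF : F ∈ finFun)
    (m n : ℕ) : Tendsto (fun s => intOp q (green q) F (m + s) (n + s)) atTop (𝓝 0) := by
  obtain ⟨N, hN⟩ := exists_bound hF
  simp only [intOp_apply q _ F N hN]
  rw [show (0 : ℂ) = ∑ k ∈ Finset.range N, ∑ l ∈ Finset.range N,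
    ((1 - (q : ℂ) ^ 2) * (((q : ℂ) ^ 2) ^ k / (((q : ℂ) ^ 2) ^ k) ^ 2) * F l k) * 0 by simp]
  exact tendsto_finsetSum _ fun k _ => tendsto_finsetSum _ fun l _ =>
    (tendsto_green_diag q m n k l).const_mul _

/-! ### Uniqueness -/

/-- A solution of the homogeneous equation which vanishes at infinity is zero. -/
theorem eq_zero_of_lap_eq_zero (q : ℝ) [hq : Fact (0 < q ∧ q < 1)] {D : Dist}
    (hD : lap ((q : ℂ) ^ 2) D = 0)
    (hlim : ∀ m n, Tendsto (fun s => D (m + s) (n + s)) atTop (𝓝 0)) : D = 0 := by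
  -- Every diagonal starts at an entry of the first row or of the first column.
  have main : ∀ m n, (m = 0 ∨ n = 0) → ∀ s, D (m + s) (n + s) = 0 := by
    intro m n hmn
    -- The equation reads `(1 - t^(m+s+1)) (D_{s+1} - D_s) = -t (1 - t^(n+s)) (D_{s-1} - D_s)` along
    -- the diagonal. Each increment is therefore a non-negative multiple of the previous one, and in
    -- units of the first entry the sequence is real and non-decreasing.
    have hgrow : ∀ s, ∃ ρ δ : ℝ, 1 ≤ ρ ∧ 0 ≤ δ ∧ D (m + s) (n + s) = ρ * D m n ∧
        D (m + s + 1) (n + s + 1) - D (m + s) (n + s) = δ * D m n := by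
      have hstep : ∀ (s : ℕ) (ρ η : ℝ), 1 ≤ ρ → 0 ≤ η → D (m + s) (n + s) = ρ * D m n →
          (1 - ((q : ℂ) ^ 2) ^ (n + s)) * (D (m + s) (n + s) - if m + s = 0 then 0 else
            D (m + s - 1) (n + s - 1)) = (η : ℂ) * D m n →
          ∃ ρ δ : ℝ, 1 ≤ ρ ∧ 0 ≤ δ ∧ D (m + s) (n + s) = ρ * D m n ∧
            D (m + s + 1) (n + s + 1) - D (m + s) (n + s) = δ * D m n := by
        intro s ρ η hρ hη h1 h2
        have h3 : lap ((q : ℂ) ^ 2) D (m + s) (n + s) = 0 := by rw [hD]; rfl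
        rw [lap_apply, mul_assoc, h2] at h3
        have h4 : (0 : ℝ) < 1 - (q ^ 2) ^ (m + s + 1) := by
          have := pow_lt_one₀ (sq_nonneg q) (sq_lt_one q) (n := m + s + 1) (by omega)
          linarith
        have h5 := one_sub_sq_pow_ne q (m + s + 1) (by omega)
        refine ⟨ρ, q ^ 2 * η / (1 - (q ^ 2) ^ (m + s + 1)), hρ, by positivity, h1, ?_⟩
        push_cast
        rw [div_mul_eq_mul_div, eq_div_iff h5]
        linear_combination -h3
      intro s
      induction s with
      | zero =>
        have h0 : (0 : ℝ) ≤ 1 - (q ^ 2) ^ n := by linarith [sq_pow_le_one q n]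
        -- For `m = 0` the predecessor is 0 by default; for `n = 0` both sides vanish with the
        -- factor `1 - t^n`.
        refine hstep 0 1 (1 - (q ^ 2) ^ n) le_rfl h0 (by simp) ?_
        rcases hmn with rfl | rfl
        · simp
        · simp
      | succ s ih =>
        obtain ⟨ρ, δ, hρ, hδ, h1, h2⟩ := ih
        have h0 : (0 : ℝ) ≤ 1 - (q ^ 2) ^ (n + (s + 1)) := by
          linarith [sq_pow_le_one q (n + (s + 1))]
        refine hstep (s + 1) (ρ + δ) ((1 - (q ^ 2) ^ (n + (s + 1))) * δ) (by linarith) (by positivity) ?_ ?_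
        · push_cast
          rw [← add_assoc, ← add_assoc]
          linear_combination h1 + h2
        · rw [if_neg (by omega), ← add_assoc, ← add_assoc, Nat.add_sub_cancel, Nat.add_sub_cancel,
            h2]
          push_cast
          ring
    have hzero : D m n = 0 := by
      have h1 : ∀ s, ‖D m n‖ ≤ ‖D (m + s) (n + s)‖ := by
        intro s
        obtain ⟨ρ, δ, hρ, -, h1, -⟩ := hgrow s
        rw [h1, norm_mul, Complex.norm_real, Real.norm_eq_abs, abs_of_nonneg (by linarith)]
        exact le_mul_of_one_le_left (norm_nonneg _) hρ
      have h2 := ge_of_tendsto' (hlim m n).norm h1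
      rw [norm_zero] at h2
      exact norm_le_zero_iff.mp h2
    intro s
    obtain ⟨ρ, δ, -, -, h1, -⟩ := hgrow s
    rw [h1, hzero, mul_zero]
  ext m n
  have h := main (m - min m n) (n - min m n) (by omega) (min m n)
  rwa [Nat.sub_add_cancel (min_le_left m n), Nat.sub_add_cancel (min_le_right m n)] at h

end QDisc

namespace QDisc

/-! ### Boundedness of `∂̄` from above and from below -/

/-- The infinite product is positive: `log(1 - x) ≥ -x/(1 - x)`, and the sum of these bounds over `x
= t^j` is dominated by a geometric series. -/
theorem exists_poch_lower_bound (q : ℝ) [hq : Fact (0 < q ∧ q < 1)] :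
    ∃ c : ℝ, 0 < c ∧ ∀ n, c ≤ poch q n := by
  have h1 := sq_lt_one q
  have h2 : 0 < 1 - q ^ 2 := by linarith
  refine ⟨Real.exp (-((1 - q ^ 2)⁻¹ * (1 - q ^ 2)⁻¹)), Real.exp_pos _, fun n => ?_⟩
  have h3 : ∀ n, Real.exp (-((1 - q ^ 2)⁻¹ * ∑ j ∈ Finset.range n, (q ^ 2) ^ j)) ≤ poch q n := by
    intro n
    induction n with
    | zero => simp [poch]
    | succ n ih =>
      rw [poch_succ, Finset.sum_range_succ, mul_add, neg_add, Real.exp_add]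
      have h4 : (q ^ 2) ^ (n + 1) ≤ q ^ 2 := by
        rw [pow_succ]
        exact mul_le_of_le_one_left (sq_nonneg q) (sq_pow_le_one q n)
      have h5 : 0 < 1 - (q ^ 2) ^ (n + 1) := by linarith
      refine mul_le_mul ih ?_ (Real.exp_pos _).le (poch_pos q n).le
      rw [pow_mul, ← Real.le_log_iff_exp_le h5]
      refine le_trans ?_ (Real.one_sub_inv_le_log_of_pos h5)
      have h6 : 1 - (1 - (q ^ 2) ^ (n + 1))⁻¹
          = -((1 - (q ^ 2) ^ (n + 1))⁻¹ * (q ^ 2) ^ (n + 1)) := by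
        field_simp
        ring
      rw [h6, neg_le_neg_iff]
      refine mul_le_mul (inv_anti₀ h2 (by linarith)) ?_ (sq_pow_pos q _).le (inv_nonneg.mpr h2.le)
      rw [pow_succ]
      exact mul_le_of_le_one_right (sq_pow_pos q n).le h1.le
  refine le_trans (Real.exp_le_exp.mpr ?_) (h3 n)
  rw [neg_le_neg_iff]
  refine mul_le_mul_of_nonneg_left ?_ (inv_nonneg.mpr h2.le)
  rw [← tsum_geometric_of_lt_one (sq_nonneg q) h1]
  exact (summable_sq_pow q).sum_le_tsum _ fun i _ => (sq_pow_pos q i).le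

theorem poch_le_one (q : ℝ) [Fact (0 < q ∧ q < 1)] (n : ℕ) : poch q n ≤ 1 := by
  simpa [poch] using poch_antitone q (Nat.zero_le n)

theorem poch_ratio_bounds (q : ℝ) [Fact (0 < q ∧ q < 1)] {c : ℝ} (hc : 0 < c)
    (h : ∀ n, c ≤ poch q n) (m n : ℕ) :
    c ≤ poch q m / poch q n ∧ poch q m / poch q n ≤ c⁻¹ := by
  constructor
  · rw [le_div_iff₀ (poch_pos q n)]
    nlinarith [h m, poch_le_one q n]
  · rw [div_eq_mul_inv, ← one_mul c⁻¹]
    exact mul_le_mul (poch_le_one q m) (inv_anti₀ hc (h n)) (inv_nonneg.mpr (poch_pos q n).le)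
      zero_le_one

/-! ### Comparison of both norms with a weighted `ℓ²` norm. -/

theorem nu_weight_eq (q : ℝ) [hq : Fact (0 < q ∧ q < 1)] (n : ℕ) :
    (1 - q ^ 2) * ((((q ^ (2 * n)) ^ 2)⁻¹) * q ^ (2 * n)) = (1 - q ^ 2) * ((q ^ 2) ^ n)⁻¹ := by
  rw [pow_mul]
  have := (sq_pow_pos q n).ne'
  field_simp

theorem norm_sq_finNu (q : ℝ) [Fact (0 < q ∧ q < 1)] (f : FinNu q) (N : ℕ)
    (hN : ∀ m n, f.toDist m n ≠ 0 → m < N ∧ n < N) :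
    ‖f‖ ^ 2 = ∑ n ∈ Finset.range N, ∑ m ∈ Finset.range N,
      ‖f.toDist m n‖ ^ 2 * (poch q m / poch q n * ((1 - q ^ 2) * ((q ^ 2) ^ n)⁻¹)) := by
  rw [@norm_sq_eq_re_inner ℂ]
  change (nu q (distMul (dagger q f.toDist) f.toDist)).re = _
  rw [nu_eq_wInt, wInt_self q _ _ N hN, Complex.ofReal_re]
  simp only [nu_weight_eq]

theorem norm_sq_finMu (q : ℝ) [Fact (0 < q ∧ q < 1)] (f : FinMu q) (N : ℕ)
    (hN : ∀ m n, f.toDist m n ≠ 0 → m < N ∧ n < N) :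
    ‖f‖ ^ 2 = ∑ n ∈ Finset.range N, ∑ m ∈ Finset.range N,
      ‖f.toDist m n‖ ^ 2 * (poch q m / poch q n * ((1 - q ^ 2) * (q ^ 2) ^ n)) := by
  rw [@norm_sq_eq_re_inner ℂ]
  change (mu q (distMul (dagger q f.toDist) f.toDist)).re = _
  rw [mu_eq_wInt, wInt_self q _ _ N hN, Complex.ofReal_re]
  simp only [pow_mul]

/-- The previous entry on the diagonal shifted by one column. -/
def shiftRow (F : Dist) : Dist := fun m n => if m = 0 then 0 else F (m - 1) n

theorem dbarDist_apply (q : ℝ) (F : Dist) (m n : ℕ) :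
    dbarDist q F m n = (1 - (q : ℂ) ^ 2)⁻¹ * (((q : ℂ) ^ 2) ^ n)⁻¹ *
      (F m (n + 1) - shiftRow F m n) := by
  rw [← pow_mul]
  rfl

theorem norm_sq_dbarDist (q : ℝ) [Fact (0 < q ∧ q < 1)] (F : Dist) (m n : ℕ) :
    ‖dbarDist q F m n‖ ^ 2
      = ((1 - q ^ 2) ^ 2)⁻¹ * (((q ^ 2) ^ n) ^ 2)⁻¹ * ‖F m (n + 1) - shiftRow F m n‖ ^ 2 := by
  have h := norm_one_sub_sq_pow q 1
  rw [pow_one, pow_one] at h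
  rw [dbarDist_apply, norm_mul, norm_mul, norm_inv, norm_inv, norm_pow, norm_sq_ofReal, h, mul_pow,
    mul_pow, inv_pow, inv_pow]

theorem norm_sub_sq_le {a b : ℂ} : ‖a - b‖ ^ 2 ≤ 2 * ‖a‖ ^ 2 + 2 * ‖b‖ ^ 2 := by
  have h := norm_sub_le a b
  nlinarith [sq_nonneg (‖a‖ - ‖b‖), norm_nonneg (a - b)]

/-- Weighted inequality `2|a||b| ≤ q|b|² + q⁻¹|a|²`. The weight `q` is adapted to `‖a‖² ≤ q² ‖b‖²`,
the relation between the two shifts after summation. -/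
theorem le_norm_sub_sq {q : ℝ} (hq : 0 < q) {a b : ℂ} :
    (1 - q) * ‖b‖ ^ 2 + (1 - q⁻¹) * ‖a‖ ^ 2 ≤ ‖a - b‖ ^ 2 := by
  have h1 := abs_norm_sub_norm_le a b
  have h2 : (‖a‖ - ‖b‖) ^ 2 ≤ ‖a - b‖ ^ 2 := by
    rw [← sq_abs]
    exact pow_le_pow_left₀ (abs_nonneg _) h1 2
  have h3 : 0 ≤ q⁻¹ * (‖a‖ - q * ‖b‖) ^ 2 := by positivity
  have h4 : q⁻¹ * (‖a‖ - q * ‖b‖) ^ 2 = q⁻¹ * ‖a‖ ^ 2 - 2 * ‖a‖ * ‖b‖ + q * ‖b‖ ^ 2 := by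
    field_simp
    ring
  nlinarith

/-- The norm of `ℓ²` with the weights `q^{-2n}`. -/
noncomputable def flatSum (q : ℝ) (N : ℕ) (F : Dist) : ℝ :=
  ∑ n ∈ Finset.range N, ∑ m ∈ Finset.range N, ‖F m n‖ ^ 2 * ((q ^ 2) ^ n)⁻¹

/-- The weights depend on the column only, so the shift of rows is isometric; the range `N + 1`
leaves room for the shifted support. -/
theorem flatSum_shiftRow (q : ℝ) (N : ℕ) (F : Dist) (hN : ∀ m n, F m n ≠ 0 → m < N ∧ n < N) :
    flatSum q (N + 1) (shiftRow F) = flatSum q (N + 1) F := by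
  refine Finset.sum_congr rfl fun n _ => ?_
  have h0 : F N n = 0 := by
    by_contra h
    exact absurd (hN _ _ h).1 (lt_irrefl N)
  rw [Finset.sum_range_succ', Finset.sum_range_succ, h0]
  simp [shiftRow]

theorem flatSum_shiftCol_le (q : ℝ) [hq : Fact (0 < q ∧ q < 1)] (N : ℕ) (F : Dist)
    (hN : ∀ m n, F m n ≠ 0 → m < N ∧ n < N) :
    flatSum q (N + 1) (fun m n => F m (n + 1)) ≤ q ^ 2 * flatSum q (N + 1) F := by
  have h0 : ∀ m, F m (N + 1) = 0 := fun m => by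
    by_contra h
    have := (hN _ _ h).2
    omega
  have h2 : q ≠ 0 := hq.out.1.ne'
  have h1 : flatSum q (N + 1) (fun m n => F m (n + 1))
      = q ^ 2 * ∑ n ∈ Finset.range (N + 1), ∑ m ∈ Finset.range (N + 1),
        ‖F m (n + 1)‖ ^ 2 * ((q ^ 2) ^ (n + 1))⁻¹ := by
    simp only [flatSum, Finset.mul_sum]
    refine Finset.sum_congr rfl fun n _ => Finset.sum_congr rfl fun m _ => ?_
    rw [pow_succ (q ^ 2) n, mul_inv]
    field_simp
  rw [h1]
  refine mul_le_mul_of_nonneg_left ?_ (sq_nonneg q)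
  -- Column `N + 1` is zero and may be added; after that the shifted sum is the full sum without
  -- column 0.
  have h3 : flatSum q (N + 1) F = ∑ n ∈ Finset.range (N + 2), ∑ m ∈ Finset.range (N + 1),
      ‖F m n‖ ^ 2 * ((q ^ 2) ^ n)⁻¹ := by
    rw [Finset.sum_range_succ _ (N + 1)]
    simp [h0, flatSum]
  rw [h3, Finset.sum_range_succ' _ (N + 1)]
  refine le_add_of_nonneg_right (Finset.sum_nonneg fun m _ => by positivity)

theorem flatSum_diff_le (q : ℝ) [hq : Fact (0 < q ∧ q < 1)] (N : ℕ) (F : Dist)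
    (hN : ∀ m n, F m n ≠ 0 → m < N ∧ n < N) :
    flatSum q (N + 1) (fun m n => F m (n + 1) - shiftRow F m n) ≤ 4 * flatSum q (N + 1) F := by
  have h1 := flatSum_shiftRow q N F hN
  have h2 := flatSum_shiftCol_le q N F hN
  have h3 : flatSum q (N + 1) (fun m n => F m (n + 1) - shiftRow F m n)
      ≤ 2 * flatSum q (N + 1) (fun m n => F m (n + 1)) + 2 * flatSum q (N + 1) (shiftRow F) := by
    simp only [flatSum, Finset.mul_sum, ← Finset.sum_add_distrib]
    refine Finset.sum_le_sum fun n _ => Finset.sum_le_sum fun m _ => ?_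
    have h4 := norm_sub_sq_le (a := F m (n + 1)) (b := shiftRow F m n)
    have h5 := (inv_pos.mpr (sq_pow_pos q n)).le
    nlinarith
  have h6 : 0 ≤ flatSum q (N + 1) F :=
    Finset.sum_nonneg fun n _ => Finset.sum_nonneg fun m _ => by positivity
  nlinarith [sq_lt_one q]

/-- An isometry minus an operator of norm at most `q` is bounded below by `1 - q`. In squares: `(1 -
q) + (1 - q⁻¹) q² = (1 - q)²`. -/
theorem le_flatSum_diff (q : ℝ) [hq : Fact (0 < q ∧ q < 1)] (N : ℕ) (F : Dist)
    (hN : ∀ m n, F m n ≠ 0 → m < N ∧ n < N) :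
    (1 - q) ^ 2 * flatSum q (N + 1) F
      ≤ flatSum q (N + 1) (fun m n => F m (n + 1) - shiftRow F m n) := by
  have h1 := flatSum_shiftRow q N F hN
  have h2 := flatSum_shiftCol_le q N F hN
  have hq0 := hq.out.1
  have h3 : (1 - q) * flatSum q (N + 1) (shiftRow F)
        + (1 - q⁻¹) * flatSum q (N + 1) (fun m n => F m (n + 1))
      ≤ flatSum q (N + 1) (fun m n => F m (n + 1) - shiftRow F m n) := by
    simp only [flatSum, Finset.mul_sum, ← Finset.sum_add_distrib]
    refine Finset.sum_le_sum fun n _ => Finset.sum_le_sum fun m _ => ?_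
    have h4 := le_norm_sub_sq hq0 (a := F m (n + 1)) (b := shiftRow F m n)
    have h5 := (inv_pos.mpr (sq_pow_pos q n)).le
    nlinarith
  have h4 : 0 ≤ q⁻¹ - 1 := by
    have := one_lt_inv₀ hq0 |>.mpr hq.out.2
    linarith
  have h5 := mul_le_mul_of_nonneg_left h2 h4
  have h6 : (q⁻¹ - 1) * (q ^ 2 * flatSum q (N + 1) F) = (1 - q) * q * flatSum q (N + 1) F := by
    field_simp
  rw [h1] at h3
  linarith

theorem exists_bound_dbarFin (q : ℝ) (f : FinNu q) (N : ℕ)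
    (hN : ∀ m n, f.toDist m n ≠ 0 → m < N ∧ n < N) (m n : ℕ)
    (h : (dbarFin q f).toDist m n ≠ 0) : m < N + 1 ∧ n < N + 1 := by
  change dbarDist q f.toDist m n ≠ 0 at h
  by_contra hmn
  refine h ?_
  have h0 : ∀ m n, ¬ (m < N ∧ n < N) → f.toDist m n = 0 := fun m n h => by
    by_contra h'
    exact h (hN m n h')
  rw [dbarDist_apply, shiftRow, h0 m (n + 1) (by omega)]
  split_ifs with h1
  · simp
  · rw [h0 (m - 1) n (by omega)]
    simp

theorem norm_dbarFin_bounds (q : ℝ) [hq : Fact (0 < q ∧ q < 1)] :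
    ∃ C c : ℝ, 0 < c ∧ ∀ f : FinNu q, ‖dbarFin q f‖ ≤ C * ‖f‖ ∧ c * ‖f‖ ≤ ‖dbarFin q f‖ := by
  obtain ⟨c, hc, hpoch⟩ := exists_poch_lower_bound q
  have ht : 0 < 1 - q ^ 2 := by linarith [sq_lt_one q]
  have hq1 : 0 < 1 - q := by linarith [hq.out.2]
  -- `S` and `D` are the flat sums of `f` and of its differences. The factor `t^{-n}` of `∂̄`, once
  -- squared, turns the weight `t^n` of `μ` into the weight `t^{-n}` of `ν`, so one flat sum serves
  -- both norms.
  have key : ∀ f : FinNu q, ∃ S D : ℝ,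
      (1 - q) ^ 2 * S ≤ D ∧ D ≤ 4 * S ∧
      c * (1 - q ^ 2) * S ≤ ‖f‖ ^ 2 ∧ ‖f‖ ^ 2 ≤ c⁻¹ * (1 - q ^ 2) * S ∧
      c * (1 - q ^ 2)⁻¹ * D ≤ ‖dbarFin q f‖ ^ 2 ∧
      ‖dbarFin q f‖ ^ 2 ≤ c⁻¹ * (1 - q ^ 2)⁻¹ * D := by
    intro f
    obtain ⟨N, hN⟩ := exists_bound f.2
    have hf := norm_sq_finNu q f (N + 1) fun m n h => by have := hN m n h; omega
    have hg := norm_sq_finMu q (dbarFin q f) (N + 1) (exists_bound_dbarFin q f N hN)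
    have hg' : ‖dbarFin q f‖ ^ 2 = ∑ n ∈ Finset.range (N + 1), ∑ m ∈ Finset.range (N + 1),
        ‖f.toDist m (n + 1) - shiftRow f.toDist m n‖ ^ 2
          * (poch q m / poch q n * ((1 - q ^ 2)⁻¹ * ((q ^ 2) ^ n)⁻¹)) := by
      rw [hg]
      refine Finset.sum_congr rfl fun n _ => Finset.sum_congr rfl fun m _ => ?_
      change ‖dbarDist q f.toDist m n‖ ^ 2 * _ = _
      rw [norm_sq_dbarDist]
      have := (sq_pow_pos q n).ne'
      field_simp
    have hsum : ∀ (H : Dist) (a : ℝ), 0 ≤ a →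
        c * a * flatSum q (N + 1) H ≤ ∑ n ∈ Finset.range (N + 1), ∑ m ∈ Finset.range (N + 1),
          ‖H m n‖ ^ 2 * (poch q m / poch q n * (a * ((q ^ 2) ^ n)⁻¹)) ∧
        ∑ n ∈ Finset.range (N + 1), ∑ m ∈ Finset.range (N + 1),
          ‖H m n‖ ^ 2 * (poch q m / poch q n * (a * ((q ^ 2) ^ n)⁻¹))
          ≤ c⁻¹ * a * flatSum q (N + 1) H := by
      intro H a ha
      simp only [flatSum, Finset.mul_sum]
      have hw : ∀ m n, 0 ≤ ‖H m n‖ ^ 2 * (a * ((q ^ 2) ^ n)⁻¹) := fun m n => by positivity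
      constructor
      · refine Finset.sum_le_sum fun n _ => Finset.sum_le_sum fun m _ => ?_
        nlinarith [mul_le_mul_of_nonneg_right (poch_ratio_bounds q hc hpoch m n).1 (hw m n)]
      · refine Finset.sum_le_sum fun n _ => Finset.sum_le_sum fun m _ => ?_
        nlinarith [mul_le_mul_of_nonneg_right (poch_ratio_bounds q hc hpoch m n).2 (hw m n)]
    obtain ⟨h1, h2⟩ := hsum f.toDist (1 - q ^ 2) ht.le
    obtain ⟨h3, h4⟩ := hsum (fun m n => f.toDist m (n + 1) - shiftRow f.toDist m n)
      (1 - q ^ 2)⁻¹ (inv_nonneg.mpr ht.le)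
    exact ⟨_, _, le_flatSum_diff q N _ hN, flatSum_diff_le q N _ hN, by rwa [hf], by rwa [hf],
      by rwa [hg'], by rwa [hg']⟩
  refine ⟨2 * (c⁻¹ * (1 - q ^ 2)⁻¹), c * (1 - q), by positivity, fun f => ?_⟩
  obtain ⟨S, D, h1, h2, h3, h4, h5, h6⟩ := key f
  have ha : 0 < c * (1 - q ^ 2)⁻¹ := by positivity
  constructor
  · have hnorm := norm_nonneg (dbarFin q f)
    refine (pow_le_pow_iff_left₀ hnorm (by positivity) two_ne_zero).mp ?_
    calc ‖dbarFin q f‖ ^ 2 ≤ c⁻¹ * (1 - q ^ 2)⁻¹ * (4 * S) :=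
          h6.trans (mul_le_mul_of_nonneg_left h2 (by positivity))
      _ = 4 * (c⁻¹ * (1 - q ^ 2)⁻¹) ^ 2 * (c * (1 - q ^ 2) * S) := by
          field_simp
      _ ≤ 4 * (c⁻¹ * (1 - q ^ 2)⁻¹) ^ 2 * ‖f‖ ^ 2 :=
          mul_le_mul_of_nonneg_left h3 (by positivity)
      _ = _ := by ring
  · refine (pow_le_pow_iff_left₀ (by positivity) (norm_nonneg _) two_ne_zero).mp ?_
    -- The estimates yield the constant `c (1 - q)/(1 - q²)`; the denominator, being less than 1, is
    -- dropped.
    have h7 : (1 - q ^ 2) * ‖f‖ ^ 2 ≤ ‖f‖ ^ 2 := by nlinarith [sq_nonneg ‖f‖, sq_nonneg q]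
    have h8 : ‖f‖ ^ 2 ≤ (1 - q ^ 2)⁻¹ * ((1 - q ^ 2)⁻¹ * ‖f‖ ^ 2) := by
      rw [← mul_assoc, ← mul_inv, ← div_eq_inv_mul, le_div_iff₀ (by positivity)]
      nlinarith [sq_nonneg ‖f‖]
    calc (c * (1 - q) * ‖f‖) ^ 2 = c ^ 2 * (1 - q) ^ 2 * ‖f‖ ^ 2 := by ring
      _ ≤ c ^ 2 * (1 - q) ^ 2 * ((1 - q ^ 2)⁻¹ * ((1 - q ^ 2)⁻¹ * ‖f‖ ^ 2)) :=
          mul_le_mul_of_nonneg_left h8 (by positivity)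
      _ ≤ c ^ 2 * (1 - q) ^ 2 * ((1 - q ^ 2)⁻¹ * ((1 - q ^ 2)⁻¹ * (c⁻¹ * (1 - q ^ 2) * S))) := by
          gcongr
      _ = c * (1 - q ^ 2)⁻¹ * ((1 - q) ^ 2 * S) := by field_simp
      _ ≤ c * (1 - q ^ 2)⁻¹ * D := mul_le_mul_of_nonneg_left h1 ha.le
      _ ≤ ‖dbarFin q f‖ ^ 2 := h5

/-! ### Extension of `∂̄` to the completions and invertibility of `□`. -/

theorem denseRange_toCompl (q : ℝ) [Fact (0 < q ∧ q < 1)] :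
    DenseRange (UniformSpace.Completion.toComplL (𝕜 := ℂ) (E := FinNu q)).toLinearMap :=
  UniformSpace.Completion.denseRange_coe

/-- The operator `∂̄` extends to a bounded operator with a bounded inverse on its range. -/
theorem exists_dbar (q : ℝ) [Fact (0 < q ∧ q < 1)] :
    ∃ dbar : L2Nu q →L[ℂ] L2Mu q, (∀ f : FinNu q, dbar f = (dbarFin q f : L2Mu q)) ∧
      ∃ c : ℝ, 0 < c ∧ ∀ u, c * ‖u‖ ≤ ‖dbar u‖ := by
  obtain ⟨C, c, hc, h⟩ := norm_dbarFin_bounds q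
  have hC : ∃ C, ∀ f : FinNu q,
      ‖((UniformSpace.Completion.toComplL (𝕜 := ℂ) (E := FinMu q)).toLinearMap ∘ₗ dbarFin q) f‖
        ≤ C * ‖(UniformSpace.Completion.toComplL (𝕜 := ℂ) (E := FinNu q)).toLinearMap f‖ := by
    refine ⟨C, fun f => ?_⟩
    change ‖(dbarFin q f : L2Mu q)‖ ≤ C * ‖(f : L2Nu q)‖
    rw [UniformSpace.Completion.norm_coe, UniformSpace.Completion.norm_coe]
    exact (h f).1
  have hcoe := LinearMap.extendOfNorm_eq (denseRange_toCompl q) hC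
  set dbar := ((UniformSpace.Completion.toComplL (𝕜 := ℂ) (E := FinMu q)).toLinearMap ∘ₗ
    dbarFin q).extendOfNorm (UniformSpace.Completion.toComplL (𝕜 := ℂ) (E := FinNu q)).toLinearMap
  have hcoe' : ∀ f : FinNu q, dbar f = (dbarFin q f : L2Mu q) := hcoe
  refine ⟨dbar, hcoe', c, hc, fun u => ?_⟩
  refine UniformSpace.Completion.induction_on u (isClosed_le (by fun_prop) (by fun_prop)) fun f => ?_
  rw [hcoe', UniformSpace.Completion.norm_coe, UniformSpace.Completion.norm_coe]
  exact (h f).2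

/-- Lax–Milgram: the form of `A* A` is `‖A x‖² ≥ c² ‖x‖²`, so the operator is coercive up to sign.
-/
theorem exists_inverse_of_bounded_below {E F : Type*} [NormedAddCommGroup E]
    [InnerProductSpace ℂ E] [CompleteSpace E] [NormedAddCommGroup F] [InnerProductSpace ℂ F]
    [CompleteSpace F] (A : E →L[ℂ] F) {c : ℝ} (hc : 0 < c) (h : ∀ u, c * ‖u‖ ≤ ‖A u‖) :
    ∃ B : E →L[ℂ] E, (-(A.adjoint ∘L A)) ∘L B = ContinuousLinearMap.id ℂ E ∧
      B ∘L (-(A.adjoint ∘L A)) = ContinuousLinearMap.id ℂ E := by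
  have hu : IsUnit (-(A.adjoint ∘L A)) := by
    refine ContinuousLinearMap.isUnit_of_forall_le_norm_inner_map _
      (c := NNReal.mk (c ^ 2) (sq_nonneg c)) (by exact_mod_cast pow_pos hc 2) fun x => ?_
    have h1 : inner ℂ ((-(A.adjoint ∘L A)) x) x = -((‖A x‖ : ℂ) ^ 2) := by
      rw [neg_apply, inner_neg_left, ContinuousLinearMap.comp_apply,
        ContinuousLinearMap.adjoint_inner_left, inner_self_eq_norm_sq_to_K]
      rfl
    rw [h1, norm_neg, norm_pow, Complex.norm_real, norm_norm, NNReal.coe_mk, ← mul_pow, mul_comm]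
    exact pow_le_pow_left₀ (by positivity) (h x) 2
  obtain ⟨U, hU⟩ := hu
  refine ⟨(U⁻¹ : (E →L[ℂ] E)ˣ), ?_, ?_⟩
  · rw [← hU]
    exact U.mul_inv
  · rw [← hU]
    exact U.inv_mul

/-! ### The equation in matrix elements -/

theorem wInt_matrixUnit (q : ℝ) (w : ℕ → ℝ) (m n : ℕ) (F : Dist) :
    wInt w (distMul (dagger q (matrixUnit q m n).toDist) F)
      = F m n * ((poch q m / poch q n * w n : ℝ) : ℂ) := by
  rw [wInt_eq q _ _ _ (m + n + 1), Finset.sum_eq_single n, Finset.sum_eq_single m]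
  · simp only [matrixUnit, FinNu.toDist, and_self, if_true, map_one, one_mul]
  · intro k _ hk
    simp [matrixUnit, FinNu.toDist, hk]
  · intro h
    exact absurd (Finset.mem_range.mpr (by omega)) h
  · intro k _ hk
    simp [matrixUnit, FinNu.toDist, hk]
  · intro h
    exact absurd (Finset.mem_range.mpr (by omega)) h
  · intro j k h
    have : j = m ∧ k = n := by
      by_contra h'
      exact h (if_neg h')
    omega

theorem inner_matrixUnit_nu (q : ℝ) [Fact (0 < q ∧ q < 1)] (m n : ℕ) (f : FinNu q) :
    inner ℂ (matrixUnit q m n) f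
      = f.toDist m n * ((poch q m / poch q n * ((1 - q ^ 2) * ((q ^ 2) ^ n)⁻¹) : ℝ) : ℂ) := by
  change nu q (distMul (dagger q (matrixUnit q m n).toDist) f.toDist) = _
  rw [nu_eq_wInt, wInt_matrixUnit, nu_weight_eq]

/-- The matrix unit as the coefficient of a form. -/
def matrixUnitMu (q : ℝ) (m n : ℕ) : FinMu q := ⟨(matrixUnit q m n).toDist, (matrixUnit q m n).2⟩

theorem inner_matrixUnitMu (q : ℝ) [Fact (0 < q ∧ q < 1)] (m n : ℕ) (g : FinMu q) :
    inner ℂ (matrixUnitMu q m n) g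
      = g.toDist m n * ((poch q m / poch q n * ((1 - q ^ 2) * (q ^ 2) ^ n) : ℝ) : ℂ) := by
  change mu q (distMul (dagger q (matrixUnit q m n).toDist) g.toDist) = _
  rw [mu_eq_wInt, wInt_matrixUnit, pow_mul]

theorem dbarFin_matrixUnit (q : ℝ) [Fact (0 < q ∧ q < 1)] (m n : ℕ) :
    dbarFin q (matrixUnit q m n)
      = (((1 - q ^ 2)⁻¹ * ((q ^ 2) ^ (n - 1))⁻¹ * (if n = 0 then 0 else 1) : ℝ) : ℂ)
          • matrixUnitMu q m (n - 1)
        - (((1 - q ^ 2)⁻¹ * ((q ^ 2) ^ n)⁻¹ : ℝ) : ℂ) • matrixUnitMu q (m + 1) n := by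
  refine Subtype.ext ?_
  change dbarDist q (matrixUnit q m n).toDist
    = (((1 - q ^ 2)⁻¹ * ((q ^ 2) ^ (n - 1))⁻¹ * (if n = 0 then 0 else 1) : ℝ) : ℂ)
          • (matrixUnit q m (n - 1)).toDist
        - (((1 - q ^ 2)⁻¹ * ((q ^ 2) ^ n)⁻¹ : ℝ) : ℂ) • (matrixUnit q (m + 1) n).toDist
  ext j k
  have hE : ∀ a b c d, (matrixUnit q a b).toDist c d = if c = a ∧ d = b then 1 else 0 :=
    fun _ _ _ _ => rfl
  rw [dbarDist_apply, shiftRow]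
  simp only [Pi.sub_apply, Pi.smul_apply, smul_eq_mul, hE]
  have e1 : ((1 - (q : ℂ) ^ 2)⁻¹ * (((q : ℂ) ^ 2) ^ k)⁻¹) * (if j = m ∧ k + 1 = n then 1 else 0)
      = (((1 - q ^ 2)⁻¹ * ((q ^ 2) ^ (n - 1))⁻¹ * (if n = 0 then 0 else 1) : ℝ) : ℂ)
        * (if j = m ∧ k = n - 1 then 1 else 0) := by
    rcases n with _ | n
    · simp
    · by_cases h : j = m ∧ k = n
      · obtain ⟨rfl, rfl⟩ := h
        simp
      · rw [if_neg (show ¬ (j = m ∧ k + 1 = n + 1) by omega),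
          if_neg (show ¬ (j = m ∧ k = n + 1 - 1) by omega)]
        simp
  have e2 : ((1 - (q : ℂ) ^ 2)⁻¹ * (((q : ℂ) ^ 2) ^ k)⁻¹)
        * (if j = 0 then 0 else if j - 1 = m ∧ k = n then 1 else 0)
      = (((1 - q ^ 2)⁻¹ * ((q ^ 2) ^ n)⁻¹ : ℝ) : ℂ) * (if j = m + 1 ∧ k = n then 1 else 0) := by
    rcases j with _ | j
    · simp
    · by_cases h : j = m ∧ k = n
      · obtain ⟨rfl, rfl⟩ := h
        simp
      · rw [if_neg (by omega), if_neg (by omega), if_neg (by omega)]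
        simp
  rw [mul_sub, e1, e2]

/-- Weak form of `∂̄* ∂̄`. The image under `∂̄` of a matrix unit has two terms, and pairing with
each gives one of the two differences in `lap`; the ratios of consecutive Pochhammer symbols supply
the factors `1 - t^n` and `1 - t^(m+1)`. -/
theorem inner_dbarFin_matrixUnit (q : ℝ) [hq : Fact (0 < q ∧ q < 1)] (m n : ℕ) (f : FinNu q) :
    inner ℂ (dbarFin q (matrixUnit q m n)) (dbarFin q f)
      = ((poch q m / poch q n * ((1 - q ^ 2)⁻¹ * ((q ^ 2) ^ n)⁻¹) : ℝ) : ℂ)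
        * lap ((q : ℂ) ^ 2) f.toDist m n := by
  have hg : ∀ m n, (dbarFin q f).toDist m n = (1 - (q : ℂ) ^ 2)⁻¹ * (((q : ℂ) ^ 2) ^ n)⁻¹ *
      (f.toDist m (n + 1) - shiftRow f.toDist m n) := dbarDist_apply q f.toDist
  have ht : (q : ℂ) ^ 2 ≠ 0 := pow_ne_zero 2 (q_ne q)
  have ht1 : 1 - (q : ℂ) ^ 2 ≠ 0 := one_sub_ne q 2 (by norm_num)
  have hpn : (poch q n : ℂ) ≠ 0 := by exact_mod_cast (poch_pos q n).ne'
  have hs : shiftRow f.toDist (m + 1) n = f.toDist m n := by simp [shiftRow]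
  rw [dbarFin_matrixUnit, inner_sub_left, inner_smul_left, inner_smul_left, inner_matrixUnitMu,
    inner_matrixUnitMu, Complex.conj_ofReal, Complex.conj_ofReal, hg, hg, hs, lap_apply, poch_succ,
    pow_mul]
  -- For `n = 0` the first of the two terms is absent, in accordance with the factor `1 - t^0` in
  -- `lap`.
  rcases n with _ | n
  · push_cast
    simp only [pow_zero, sub_self]
    field_simp
    ring
  · have hpn' : (poch q n : ℂ) ≠ 0 := by exact_mod_cast (poch_pos q n).ne'
    have h1 := one_sub_sq_pow_ne q (n + 1) (by omega)
    have hs' : shiftRow f.toDist m n = if m = 0 then 0 else f.toDist (m - 1) (n + 1 - 1) := rfl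
    rw [← hs', poch_succ, pow_mul]
    push_cast
    field_simp
    ring

theorem l2ToDist_inner (q : ℝ) [Fact (0 < q ∧ q < 1)] (m n : ℕ) (u : L2Nu q) :
    inner ℂ (matrixUnit q m n : L2Nu q) u
      = l2ToDist q u m n * ((poch q m / poch q n * ((1 - q ^ 2) * ((q ^ 2) ^ n)⁻¹) : ℝ) : ℂ) := by
  have hc := continuous_l2ToDist q
  refine UniformSpace.Completion.induction_on u (isClosed_eq (by fun_prop) (by fun_prop))
    fun f => ?_
  rw [UniformSpace.Completion.inner_coe, inner_matrixUnit_nu, l2ToDist_coe]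

theorem inner_dbar_matrixUnit (q : ℝ) [Fact (0 < q ∧ q < 1)] (dbar : L2Nu q →L[ℂ] L2Mu q)
    (hdbar : ∀ f : FinNu q, dbar f = (dbarFin q f : L2Mu q)) (m n : ℕ) (u : L2Nu q) :
    inner ℂ (dbar (matrixUnit q m n : L2Nu q)) (dbar u)
      = ((poch q m / poch q n * ((1 - q ^ 2)⁻¹ * ((q ^ 2) ^ n)⁻¹) : ℝ) : ℂ)
        * lap ((q : ℂ) ^ 2) (l2ToDist q u) m n := by
  have hc := (continuous_lap ((q : ℂ) ^ 2)).comp (continuous_l2ToDist q)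
  have hc' : Continuous fun u => lap ((q : ℂ) ^ 2) (l2ToDist q u) m n :=
    (continuous_apply n).comp ((continuous_apply m).comp hc)
  refine UniformSpace.Completion.induction_on u (isClosed_eq (by fun_prop) (by fun_prop))
    fun f => ?_
  rw [hdbar, hdbar, UniformSpace.Completion.inner_coe, inner_dbarFin_matrixUnit, l2ToDist_coe]

/-- The equation is tested against matrix units. The weights on the two sides differ by `(1 - t)²`,
which is the constant in the conclusion. -/
theorem lap_l2ToDist (q : ℝ) [hq : Fact (0 < q ∧ q < 1)] (dbar : L2Nu q →L[ℂ] L2Mu q)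
    (hdbar : ∀ f : FinNu q, dbar f = (dbarFin q f : L2Mu q)) (u v : L2Nu q)
    (h : (-(dbar.adjoint ∘L dbar)) u = v) :
    lap ((q : ℂ) ^ 2) (l2ToDist q u) = (-(1 - (q : ℂ) ^ 2) ^ 2) • l2ToDist q v := by
  ext m n
  have h1 := congrArg (inner ℂ (matrixUnit q m n : L2Nu q)) h
  rw [neg_apply, inner_neg_right, ContinuousLinearMap.comp_apply,
    ContinuousLinearMap.adjoint_inner_right, inner_dbar_matrixUnit q dbar hdbar,
    l2ToDist_inner] at h1
  have ht : (q : ℂ) ^ 2 ≠ 0 := pow_ne_zero 2 (q_ne q)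
  have ht1 : 1 - (q : ℂ) ^ 2 ≠ 0 := one_sub_ne q 2 (by norm_num)
  have hpn : (poch q n : ℂ) ≠ 0 := by exact_mod_cast (poch_pos q n).ne'
  have hpm : (poch q m : ℂ) ≠ 0 := by exact_mod_cast (poch_pos q m).ne'
  push_cast at h1
  field_simp at h1
  simp only [Pi.smul_apply, smul_eq_mul]
  linear_combination -h1

/-- Cauchy–Schwarz against the matrix unit, whose squared norm is the weight. -/
theorem norm_l2ToDist_sq_le (q : ℝ) [Fact (0 < q ∧ q < 1)] (m n : ℕ) (u : L2Nu q) :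
    ‖l2ToDist q u m n‖ ^ 2 * (poch q m / poch q n * ((1 - q ^ 2) * ((q ^ 2) ^ n)⁻¹)) ≤ ‖u‖ ^ 2 := by
  set κ : ℝ := poch q m / poch q n * ((1 - q ^ 2) * ((q ^ 2) ^ n)⁻¹) with hκ
  have hpos : 0 < κ := mul_pos (div_pos (poch_pos q m) (poch_pos q n))
    (mul_pos (by linarith [sq_lt_one q]) (inv_pos.mpr (sq_pow_pos q n)))
  have h1 : ‖(matrixUnit q m n : L2Nu q)‖ ^ 2 = κ := by
    have h2 : (matrixUnit q m n).toDist m n = 1 := if_pos ⟨rfl, rfl⟩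
    rw [@norm_sq_eq_re_inner ℂ, UniformSpace.Completion.inner_coe, inner_matrixUnit_nu, h2, one_mul]
    exact Complex.ofReal_re κ
  have h3 := norm_inner_le_norm (𝕜 := ℂ) (matrixUnit q m n : L2Nu q) u
  rw [l2ToDist_inner, norm_mul, Complex.norm_real, Real.norm_eq_abs, abs_of_pos hpos] at h3
  have h4 := pow_le_pow_left₀ (by positivity) h3 2
  rw [mul_pow _ κ, mul_pow _ ‖u‖, h1] at h4
  refine le_of_mul_le_mul_left ?_ hpos
  linarith

theorem tendsto_l2ToDist_diag (q : ℝ) [Fact (0 < q ∧ q < 1)] (u : L2Nu q) (m n : ℕ) :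
    Tendsto (fun s => l2ToDist q u (m + s) (n + s)) atTop (𝓝 0) := by
  obtain ⟨c, hc, hpoch⟩ := exists_poch_lower_bound q
  have ht : 0 < 1 - q ^ 2 := by linarith [sq_lt_one q]
  have hbound : ∀ s, ‖l2ToDist q u (m + s) (n + s)‖ ^ 2
      ≤ ‖u‖ ^ 2 * (c * (1 - q ^ 2))⁻¹ * (q ^ 2) ^ (n + s) := by
    intro s
    have h1 := norm_l2ToDist_sq_le q (m + s) (n + s) u
    have h2 := (poch_ratio_bounds q hc hpoch (m + s) (n + s)).1
    have h3 := sq_pow_pos q (n + s)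
    have h4 : ‖l2ToDist q u (m + s) (n + s)‖ ^ 2 * (c * ((1 - q ^ 2) * ((q ^ 2) ^ (n + s))⁻¹))
        ≤ ‖u‖ ^ 2 := le_trans (by gcongr) h1
    have h5 : c * ((1 - q ^ 2) * ((q ^ 2) ^ (n + s))⁻¹)
        = c * (1 - q ^ 2) / (q ^ 2) ^ (n + s) := by
      rw [div_eq_mul_inv, mul_assoc]
    rw [h5, ← le_div_iff₀ (by positivity)] at h4
    refine h4.trans (le_of_eq ?_)
    field_simp
  have hlim : Tendsto (fun s => ‖l2ToDist q u (m + s) (n + s)‖ ^ 2) atTop (𝓝 0) := by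
    refine squeeze_zero (fun s => sq_nonneg _) hbound ?_
    rw [← mul_zero (‖u‖ ^ 2 * (c * (1 - q ^ 2))⁻¹)]
    refine Tendsto.const_mul _ ?_
    refine (tendsto_pow_atTop_nhds_zero_of_lt_one (sq_nonneg q) (sq_lt_one q)).comp ?_
    exact tendsto_atTop_mono (fun s => Nat.le_add_left s n) tendsto_id
  rw [tendsto_zero_iff_norm_tendsto_zero]
  simpa using hlim.sqrt

end QDisc

/-! ### The inverse of `□` as the integral operator with kernel `G`. -/

theorem theorem3p5 (q : ℝ) [Fact (0 < q ∧ q < 1)] :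
    -- the kernels `G_m` are well defined, and the series for the Green function converges
    (∀ m : ℕ, Tendsto (fun N => QDisc.toDist₂ q (QDisc.truncG q m N)) atTop (𝓝 (QDisc.G q m))) ∧
    HasSum (fun m : ℕ => -QDisc.greenTerm q (m + 1)) (QDisc.green q) ∧
    -- `∂̄` extends to a bounded operator, and `□ = -∂̄* ∂̄` has a bounded inverse
    ∃ dbar : QDisc.L2Nu q →L[ℂ] QDisc.L2Mu q,
      (∀ f : QDisc.FinNu q, dbar f = (QDisc.dbarFin q f : QDisc.L2Mu q)) ∧
      ∃ boxInv : QDisc.L2Nu q →L[ℂ] QDisc.L2Nu q,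
        (-(dbar.adjoint ∘L dbar)) ∘L boxInv = ContinuousLinearMap.id ℂ (QDisc.L2Nu q) ∧
        boxInv ∘L (-(dbar.adjoint ∘L dbar)) = ContinuousLinearMap.id ℂ (QDisc.L2Nu q) ∧
        -- on finite functions it is the integral operator whose kernel is the Green function
        ∀ f : QDisc.FinNu q,
          QDisc.l2ToDist q (boxInv (f : QDisc.L2Nu q)) = QDisc.intOp q (QDisc.green q) f.toDist := by
  refine ⟨fun m => ?_, QDisc.hasSum_green q, ?_⟩
  · rw [QDisc.G, (QDisc.tendsto_truncG q m).limUnder_eq]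
    exact QDisc.tendsto_truncG q m
  obtain ⟨dbar, hdbar, c, hc, hbelow⟩ := QDisc.exists_dbar q
  obtain ⟨B, hB1, hB2⟩ := QDisc.exists_inverse_of_bounded_below dbar hc hbelow
  refine ⟨dbar, hdbar, B, hB1, hB2, fun f => ?_⟩
  have h1 := QDisc.lap_l2ToDist q dbar hdbar (B f) f
    (congrArg (fun A : QDisc.L2Nu q →L[ℂ] QDisc.L2Nu q => A f) hB1)
  rw [QDisc.l2ToDist_coe] at h1
  have hf : f.toDist ∈ QDisc.finFun := f.2
  -- Membership of the integral in `L²(dν)_q` is not needed: uniqueness is applied to distributions,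
  -- and decay along diagonals suffices.
  refine sub_eq_zero.mp (QDisc.eq_zero_of_lap_eq_zero q ?_ fun m n => ?_)
  · rw [map_sub, h1, QDisc.lap_intOp_green q hf, sub_self]
  · rw [← sub_zero (0 : ℂ)]
    exact (QDisc.tendsto_l2ToDist_diag q (B f) m n).sub (QDisc.tendsto_intOp_green_diag q hf m n)
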